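/- Let $n\ge 1$ and let $(M^{2n},\omega,\theta)$ be a locally conformal symplectic manifold: $M$ is a smooth $2n$-manifold, $\omega$ a smooth non-degenerate 2-form and $\theta$ a smooth closed 1-form with $d\omega=-\omega\wedge\theta$. Let $\Omega^k=\Omega^k(M)$ be the smooth $k$-forms ($\Omega^k=0$ for $k<0$), $\Omega^*=\bigoplus_k\Omega^k$, $L\alpha=\omega\wedge\alpha$, and for $l\in\mathbb Z$ let $d_l\alpha=d\alpha+l\,\theta\wedge\alpha$. Then $d_l^2=0$ and $d_lL=Ld_{l-1}$. Put $$H^k_l=H^k_l(M)=\frac{\ker d_l\cap\Omega^k}{d_l\Omega^{k-1}} .$$ Let $\mathcal P^k=\{\alpha\in\Omega^k: L^{n-k+1}\alpha=0\}$ for $0\le k\le n$, $\mathcal P^k=0$ otherwise, $\mathcal P^*=\bigoplus_k\mathcal P^k$, and let $\Pi_{pr}:\Omega^*=\mathcal P^*\oplus L\Omega^*\to\mathcal P^*$ be the Lefschetz projection. Put $d_l^+=\Pi_{pr}d_l$ and let $d_l^-:\Omega^k\to\Omega^{k-1}$ ($0\le k\le n$) be the operator determined by $d_l=d_l^++Ld_l^-$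 (recall that $L$ is injective on $\Omega^{j}$ for $j\le n-1$). For $0\le k\le n$ put $$C^k_l=\frac{\ker d_l^-\cap\Omega^k}{d_l\Omega^{k-1}} .$$ Let $E^{p,q}_{k,r}$ be the spectral sequence of the complex $(\Omega^*,d_k)$ filtered by $F^p=L^p\Omega^*$ ($F^p=\Omega^*$ for $p\le 0$); thus $E^{p,q}_{k,1}=Z^{p,q}/(F^{p+1}\Omega^{p+q}+d_kF^p\Omega^{p+q-1})$ with $F^p\Omega^{m}=F^p\cap\Omega^m$ and $Z^{p,q}=\{a\in F^p\Omega^{p+q}: d_ka\in F^{p+1}\}$. Let $l\in\mathbb Z$ and $0\le p\le n-1$. The following maps are well defined, linear, and determined by the given formulas: * $\bar L:H^{k}_{l-1}\to H^{k+2}_l$, $[\alpha]\mapsto[L\alpha]$, and $\bar L^p:H^{k}_l\to E^{p,p+k}_{l+p,1}$, $[\alpha]\mapsto[L^p\alpha]$, for all $k\in\mathbb Z$; * for $p\le q\le n-1$: $\delta_{p,q}:E^{p,q}_{l+p,1}\to H^{q-(p+1)}_{l-1}$, $[L^p\alpha]\mapsto[d_l^-\alpha]$ for $\alpha\in\mathcal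 P^{q-p}$ with $d_l^+\alpha=0$ (every class has such a representative $L^p\alpha$); * $[L]:H^{n-(p+2)}_{l-1}\to C^{n-p}_l$, $[\alpha]\mapsto[L\alpha]$; * $[L^p]:C^{n-p}_l\to E^{p,n}_{l+p,1}$, $[\alpha]\mapsto[L^p\,\Pi_{pr}\alpha]$; * $\delta_{p,n}:E^{p,n}_{l+p,1}\to C^{n-(p+1)}_{l-1}$, $[L^p\alpha]\mapsto[d_l^-\alpha]$ for $\alpha\in\mathcal P^{n-p}$ (every class has such a representative $L^p\alpha$); * $[L^{p+1}]:C^{n-(p+1)}_{l-1}\to H^{n+p+1}_{l+p}$, $[\alpha]\mapsto[L^{p+1}\alpha]$. With these maps the long sequence $$\cdots\to H^{q-p}_l\xrightarrow{\bar L^p}E^{p,q}_{l+p,1}\xrightarrow{\delta_{p,q}}H^{q-(p+1)}_{l-1}\xrightarrow{\bar L}H^{q+1-p}_l\xrightarrow{\bar L^p}E^{p,q+1}_{l+p,1}\to\cdots\qquad(p\le q\le n-1)$$ is exact at $E^{p,q}_{l+p,1}$ and at $H^{q-(p+1)}_{l-1}$ for $p\le q\le n-1$, and at $H^{q-p}_l$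 for $p\le q\le n$, and it can be extended through $q=n$: the sequence $$E^{p,n-1}_{l+p,1}\xrightarrow{\delta_{p,n-1}}H^{n-(p+2)}_{l-1}\xrightarrow{[L]}C^{n-p}_l\xrightarrow{[L^p]}E^{p,n}_{l+p,1}\xrightarrow{\delta_{p,n}}C^{n-(p+1)}_{l-1}\xrightarrow{[L^{p+1}]}H^{n+p+1}_{l+p}\to 0$$ is exact. -/

import Mathlib

open scoped Manifold Topology

noncomputable section

namespace LCS

section Linear
variable {V : Type*} [NormedAddCommGroup V] [NormedSpace ℝ V]

/-- The exterior product `θ ∧ α` of a covector with a `k`-form, as a bilinear map. -/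
def wedgeOneL (V : Type*) [NormedAddCommGroup V] [NormedSpace ℝ V] (k : ℕ) :
    (V [⋀^Fin 1]→L[ℝ] ℝ) →L[ℝ] (V [⋀^Fin k]→L[ℝ] ℝ) →L[ℝ] (V [⋀^Fin (k + 1)]→L[ℝ] ℝ) :=
  (ContinuousLinearMap.compL ℝ _ _ _
      (ContinuousAlternatingMap.alternatizeUncurryFinCLM ℝ V ℝ)) ∘L
    (ContinuousLinearMap.smulRightL ℝ V (V [⋀^Fin k]→L[ℝ] ℝ)) ∘L
    ((ContinuousAlternatingMap.ofSubsingletonLIE (𝕜 := ℝ) (E := V) (F := ℝ)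
      (0 : Fin 1)).symm.toContinuousLinearEquiv : (V [⋀^Fin 1]→L[ℝ] ℝ) →L[ℝ] (V →L[ℝ] ℝ))

theorem wedgeOneL_apply {k : ℕ} (θ : V [⋀^Fin 1]→L[ℝ] ℝ) (α : V [⋀^Fin k]→L[ℝ] ℝ)
    (v : Fin (k + 1) → V) :
    wedgeOneL V k θ α v = ∑ i : Fin (k + 1), (-1) ^ (i : ℕ) * (θ ![v i] * α (i.removeNth v)) := by
  have h : ∀ x : V, (fun _ : Fin 1 => x) = ![x] := fun x => by ext i; simp
  simp [wedgeOneL, ContinuousAlternatingMap.alternatizeUncurryFin_apply, h]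

/-- The exterior product `ω ∧ α` of a `2`-form with a `k`-form, as a bilinear map:
`ω ∧ α = ½ ∑ eⁱ ∧ (ι_{eᵢ} ω) ∧ α`. -/
def wedgeTwoL (V : Type*) [NormedAddCommGroup V] [NormedSpace ℝ V] (k : ℕ) :
    (V [⋀^Fin 2]→L[ℝ] ℝ) →L[ℝ] (V [⋀^Fin k]→L[ℝ] ℝ) →L[ℝ] (V [⋀^Fin (k + 2)]→L[ℝ] ℝ) :=
  ContinuousLinearMap.flip <|
    (1 / 2 : ℝ) • (ContinuousLinearMap.precomp _
        (ContinuousAlternatingMap.curryLeftLI (𝕜 := ℝ) (E := V) (F := ℝ)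
            (n := 1)).toContinuousLinearMap) ∘L
    ((ContinuousLinearMap.compL ℝ _ _ _
      (ContinuousAlternatingMap.alternatizeUncurryFinCLM ℝ V ℝ)) ∘L
      (ContinuousLinearMap.compL ℝ V _ _) ∘L (wedgeOneL V k).flip)

theorem wedgeTwoL_apply {k : ℕ} (ω : V [⋀^Fin 2]→L[ℝ] ℝ) (α : V [⋀^Fin k]→L[ℝ] ℝ)
    (v : Fin (k + 2) → V) :
    wedgeTwoL V k ω α v = (1 / 2) * ∑ i : Fin (k + 2), ∑ j : Fin (k + 1),
      (-1) ^ ((i : ℕ) + (j : ℕ)) *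
        (ω ![v i, i.removeNth v j] * α (j.removeNth (i.removeNth v))) := by
  simp [wedgeTwoL, ContinuousAlternatingMap.alternatizeUncurryFin_apply, wedgeOneL_apply, Finset.mul_sum, pow_add, mul_assoc]

theorem wedgeOneL_comp {W : Type*} [NormedAddCommGroup W] [NormedSpace ℝ W] {k : ℕ}
   (θ : V [⋀^Fin 1]→L[ℝ] ℝ) (α : V [⋀^Fin k]→L[ℝ] ℝ) (f : W →L[ℝ] V) :
   (wedgeOneL V k θ α).compContinuousLinearMap f =
     wedgeOneL W k (θ.compContinuousLinearMap f) (α.compContinuousLinearMap f) := by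
  ext v
  simp only [ContinuousAlternatingMap.compContinuousLinearMap_apply, wedgeOneL_apply]
  refine Finset.sum_congr rfl fun i _ => ?_
  congr 3
  ext j; simp

theorem wedgeTwoL_comp {W : Type*} [NormedAddCommGroup W] [NormedSpace ℝ W] {k : ℕ}
   (ω : V [⋀^Fin 2]→L[ℝ] ℝ) (α : V [⋀^Fin k]→L[ℝ] ℝ) (f : W →L[ℝ] V) :
   (wedgeTwoL V k ω α).compContinuousLinearMap f =
     wedgeTwoL W k (ω.compContinuousLinearMap f) (α.compContinuousLinearMap f) := by
  ext v
  simp only [ContinuousAlternatingMap.compContinuousLinearMap_apply, wedgeTwoL_apply]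
  congr 1
  refine Finset.sum_congr rfl fun i _ => Finset.sum_congr rfl fun j _ => ?_
  congr 3
  ext j; fin_cases j <;> simp [Fin.removeNth]

end Linear

section Forms

/-- `ℝᵐ` with its Euclidean norm, the model space. -/
abbrev Model (m : ℕ) : Type := EuclideanSpace ℝ (Fin m)

variable {m : ℕ} {M : Type*} [TopologicalSpace M] [ChartedSpace (Model m) M]

/-- Not necessarily smooth `k`-forms on `M`: a family of alternating forms on tangent spaces. -/
abbrev RoughForm (m : ℕ) (M : Type*) [TopologicalSpace M] [ChartedSpace (Model m) M] (k : ℕ) :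
    Type _ :=
  (x : M) → TangentSpace (𝓡 m) x [⋀^Fin k]→L[ℝ] ℝ

/-- The expression of a form in the chart `e`: the pullback of the form under `e.symm`. -/
def localRep {k : ℕ} (e : OpenPartialHomeomorph M (Model m)) (α : RoughForm m M k) (y : Model m) :
    Model m [⋀^Fin k]→L[ℝ] ℝ :=
  (α (e.symm y)).compContinuousLinearMap (mfderiv (𝓡 m) (𝓡 m) e.symm y)

/-- A form is smooth if its expression in every chart of the atlas is smooth. -/
def IsSmooth {k : ℕ} (α : RoughForm m M k) : Prop :=
  ∀ e ∈ atlas (Model m) M, ContDiffOn ℝ (⊤ : ℕ∞) (localRep e α) e.target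

theorem localRep_add {k : ℕ} (e : OpenPartialHomeomorph M (Model m)) (α β : RoughForm m M k) :
    localRep e (α + β) = localRep e α + localRep e β := by
  rfl

theorem localRep_smul {k : ℕ} (e : OpenPartialHomeomorph M (Model m)) (c : ℝ)
    (α : RoughForm m M k) : localRep e (c • α) = c • localRep e α := by
  rfl

theorem localRep_zero {k : ℕ} (e : OpenPartialHomeomorph M (Model m)) :
    localRep e (0 : RoughForm m M k) = 0 := by
  rfl

/-- The space `Ωᵏ(M)` of smooth `k`-forms. -/
def Form (m : ℕ) (M : Type*) [TopologicalSpace M] [ChartedSpace (Model m) M] (k : ℕ) :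
    Submodule ℝ (RoughForm m M k) where
  carrier := {α | IsSmooth α}
  add_mem' {α β} hα hβ e he := by
    rw [localRep_add]; exact (hα e he).add (hβ e he)
  zero_mem' e he := by
    rw [localRep_zero]; exact contDiffOn_const
  smul_mem' c α hα e he := by
    rw [localRep_smul]; exact (hα e he).const_smul c

/-- Pointwise exterior product of a `1`-form with a `k`-form. -/
def wedgeOneRough {k : ℕ} (θ : RoughForm m M 1) (α : RoughForm m M k) : RoughForm m M (k + 1) :=
  fun x => wedgeOneL (Model m) k (θ x) (α x)

/-- Pointwise exterior product of a `2`-form with a `k`-form. -/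
def wedgeTwoRough {k : ℕ} (ω : RoughForm m M 2) (α : RoughForm m M k) : RoughForm m M (k + 2) :=
  fun x => wedgeTwoL (Model m) k (ω x) (α x)

theorem IsSmooth.wedgeOne {k : ℕ} {θ : RoughForm m M 1} {α : RoughForm m M k}
    (hθ : IsSmooth θ) (hα : IsSmooth α) : IsSmooth (wedgeOneRough θ α) := fun e he =>
  (((wedgeOneL (Model m) k).contDiff.comp_contDiffOn (hθ e he)).clm_apply (hα e he)).congr
    fun y _ => wedgeOneL_comp (V := Model m) (W := Model m) (θ (e.symm y)) (α (e.symm y)) _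

theorem IsSmooth.wedgeTwo {k : ℕ} {ω : RoughForm m M 2} {α : RoughForm m M k}
    (hω : IsSmooth ω) (hα : IsSmooth α) : IsSmooth (wedgeTwoRough ω α) := fun e he =>
  (((wedgeTwoL (Model m) k).contDiff.comp_contDiffOn (hω e he)).clm_apply (hα e he)).congr
    fun y _ => wedgeTwoL_comp (V := Model m) (W := Model m) (ω (e.symm y)) (α (e.symm y)) _

/-- Exterior product with a smooth `1`-form, `α ↦ θ ∧ α`. -/
def wedgeOne (θ : Form m M 1) (k : ℕ) : Form m M k →ₗ[ℝ] Form m M (k + 1) where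
  toFun α := ⟨wedgeOneRough θ.1 α.1, IsSmooth.wedgeOne θ.2 α.2⟩
  map_add' α β := Subtype.ext <| funext fun x =>
    (wedgeOneL (Model m) k (θ.1 x)).map_add (α.1 x) (β.1 x)
  map_smul' c α := Subtype.ext <| funext fun x =>
    (wedgeOneL (Model m) k (θ.1 x)).map_smul c (α.1 x)

/-- Exterior product with a smooth `2`-form, `α ↦ ω ∧ α`. -/
def wedgeTwo (ω : Form m M 2) (k : ℕ) : Form m M k →ₗ[ℝ] Form m M (k + 2) where
  toFun α := ⟨wedgeTwoRough ω.1 α.1, IsSmooth.wedgeTwo ω.2 α.2⟩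
  map_add' α β := Subtype.ext <| funext fun x =>
    (wedgeTwoL (Model m) k (ω.1 x)).map_add (α.1 x) (β.1 x)
  map_smul' c α := Subtype.ext <| funext fun x =>
    (wedgeTwoL (Model m) k (ω.1 x)).map_smul c (α.1 x)

/-- The exterior derivative: at `x` it is computed in the preferred chart at `x` and pulled back to
the tangent space at `x`. By `localRep_extDRough` any other chart gives the same result. -/
def extDRough {k : ℕ} (α : RoughForm m M k) : RoughForm m M (k + 1) := fun x =>
  (extDeriv (localRep (chartAt (Model m) x) α) (chartAt (Model m) x x)).compContinuousLinearMap
    (mfderiv (𝓡 m) (𝓡 m) (chartAt (Model m) x) x : TangentSpace (𝓡 m) x →L[ℝ] Model m)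

theorem differentiableAt_localRep {k : ℕ} {α : RoughForm m M k} (hα : IsSmooth α) (x : M) :
    DifferentiableAt ℝ (localRep (chartAt (Model m) x) α) (chartAt (Model m) x x) :=
  ((hα _ (chart_mem_atlas _ x)).contDiffAt ((chartAt (Model m) x).open_target.mem_nhds
    (mem_chart_target _ x))).differentiableAt (by simp)

section Smooth
variable [IsManifold (𝓡 m) (⊤ : ℕ∞) M]

theorem contDiffAt_transition {e e' : OpenPartialHomeomorph M (Model m)}
    (he : e ∈ atlas (Model m) M) (he' : e' ∈ atlas (Model m) M) {y : Model m}
    (hy : y ∈ e.target) (hy' : e.symm y ∈ e'.source) :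
    ContDiffAt ℝ (⊤ : ℕ∞) (e' ∘ e.symm) y := by
  have h1 : ContMDiffAt (𝓡 m) (𝓡 m) (⊤ : ℕ∞) e.symm y :=
    (contMDiffOn_symm_of_mem_maximalAtlas
      (IsManifold.subset_maximalAtlas he)).contMDiffAt (e.open_target.mem_nhds hy)
  have h2 : ContMDiffAt (𝓡 m) (𝓡 m) (⊤ : ℕ∞) e' (e.symm y) :=
    (contMDiffOn_of_mem_maximalAtlas
      (IsManifold.subset_maximalAtlas he')).contMDiffAt (e'.open_source.mem_nhds hy')
  exact (h2.comp y h1).contDiffAt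

theorem mfderiv_symm_eq {e e' : OpenPartialHomeomorph M (Model m)}
    (he : e ∈ atlas (Model m) M) (he' : e' ∈ atlas (Model m) M) {y : Model m}
    (hy : y ∈ e.target) (hy' : e.symm y ∈ e'.source) (v : Model m) :
    (mfderiv (𝓡 m) (𝓡 m) e.symm y v : Model m) =
      mfderiv (𝓡 m) (𝓡 m) e'.symm (e' (e.symm y)) (fderiv ℝ (e' ∘ e.symm) y v) := by
  have hev : e.symm =ᶠ[𝓝 y] e'.symm ∘ (e' ∘ e.symm) := by
    have hc : ContinuousAt e.symm y := e.symm.continuousAt hy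
    filter_upwards [hc.preimage_mem_nhds (e'.open_source.mem_nhds hy')] with z hz
    exact (e'.left_inv hz).symm
  have hτ : MDifferentiableAt (𝓡 m) (𝓡 m) (e' ∘ e.symm) y :=
    ((contDiffAt_transition he he' hy hy').differentiableAt (by simp)).mdifferentiableAt
  have hs : MDifferentiableAt (𝓡 m) (𝓡 m) e'.symm ((e' ∘ e.symm) y) := by
    have : IsManifold (𝓡 m) 1 M := IsManifold.of_le (n := (⊤ : ℕ∞)) (by exact_mod_cast le_top)
    exact mdifferentiableAt_atlas_symm he' (e'.map_source hy')
  rw [hev.mfderiv_eq, mfderiv_comp y hs hτ, mfderiv_eq_fderiv]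
  rfl

theorem localRep_change {k : ℕ} (α : RoughForm m M k) {e e' : OpenPartialHomeomorph M (Model m)}
    (he : e ∈ atlas (Model m) M) (he' : e' ∈ atlas (Model m) M) {y : Model m}
    (hy : y ∈ e.target) (hy' : e.symm y ∈ e'.source) :
    localRep e α y = (localRep e' α ((e' ∘ e.symm) y)).compContinuousLinearMap
      (fderiv ℝ (e' ∘ e.symm) y) := by
  ext v
  simp only [localRep, ContinuousAlternatingMap.compContinuousLinearMap_apply, Function.comp_def]
  have hx : e'.symm (e' (e.symm y)) = e.symm y := e'.left_inv hy'
  have key : ∀ (x x' : M) (_ : x = x') (u w : Fin k → Model m) (_ : u = w),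
      (α x : Model m [⋀^Fin k]→L[ℝ] ℝ) u = (α x' : Model m [⋀^Fin k]→L[ℝ] ℝ) w := by
    rintro x _ rfl u _ rfl; rfl
  exact key _ _ hx.symm _ _ (funext fun i => mfderiv_symm_eq he he' hy hy' (v i))

theorem localRep_extDRough {k : ℕ} {α : RoughForm m M k} (hα : IsSmooth α)
    {e : OpenPartialHomeomorph M (Model m)} (he : e ∈ atlas (Model m) M) {y : Model m}
    (hy : y ∈ e.target) : localRep e (extDRough α) y = extDeriv (localRep e α) y := by
  set e' := chartAt (Model m) (e.symm y) with he'def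
  have he' : e' ∈ atlas (Model m) M := chart_mem_atlas _ _
  have hy' : e.symm y ∈ e'.source := mem_chart_source _ _
  have hsm := contDiffAt_transition he he' hy hy'
  have hev : localRep e α =ᶠ[𝓝 y] fun z => (localRep e' α ((e' ∘ e.symm) z)).compContinuousLinearMap
      (fderiv ℝ (e' ∘ e.symm) z) := by
    filter_upwards [(e.symm.continuousAt hy).preimage_mem_nhds (e'.open_source.mem_nhds hy'),
      e.open_target.mem_nhds hy] with z hz hz'
    exact localRep_change α he he' hz' hz
  have hd : DifferentiableAt ℝ (localRep e' α) ((e' ∘ e.symm) y) :=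
    ((hα e' he').contDiffAt (e'.open_target.mem_nhds (e'.map_source hy'))).differentiableAt
      (by simp)
  rw [hev.extDeriv_eq, extDeriv_pullback hd hsm (by simp; exact WithTop.coe_le_coe.2 le_top)]
  have : IsManifold (𝓡 m) 1 M := IsManifold.of_le (n := (⊤ : ℕ∞)) (by exact_mod_cast le_top)
  have h1 : MDifferentiableAt (𝓡 m) (𝓡 m) e.symm y := mdifferentiableAt_atlas_symm he hy
  have h2 : MDifferentiableAt (𝓡 m) (𝓡 m) e' (e.symm y) := mdifferentiableAt_atlas he' hy'
  have hc := mfderiv_comp y h2 h1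
  rw [mfderiv_eq_fderiv] at hc
  rw [hc]
  rfl

theorem IsSmooth.extD {k : ℕ} {α : RoughForm m M k} (hα : IsSmooth α) :
    IsSmooth (extDRough α) := fun e he => by
  have h : ContDiffOn ℝ (⊤ : ℕ∞) (extDeriv (localRep e α)) e.target := by
    have h1 : ContDiffOn ℝ (⊤ : ℕ∞) (fderiv ℝ (localRep e α)) e.target :=
      (hα e he).fderiv_of_isOpen e.open_target (by simp)
    exact (ContinuousAlternatingMap.alternatizeUncurryFinCLM ℝ (Model m) ℝ).contDiff.comp_contDiffOn
      h1
  exact h.congr fun y hy => localRep_extDRough hα he hy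

/-- The exterior derivative `d : Ωᵏ(M) → Ωᵏ⁺¹(M)`. -/
def extD (k : ℕ) : Form m M k →ₗ[ℝ] Form m M (k + 1) where
  toFun α := ⟨extDRough α.1, IsSmooth.extD α.2⟩
  map_add' α β := Subtype.ext <| funext fun x => by
    change extDRough (α.1 + β.1) x = extDRough α.1 x + extDRough β.1 x
    simp only [extDRough]
    rw [localRep_add, extDeriv_add (differentiableAt_localRep α.2 x)
      (differentiableAt_localRep β.2 x)]
    rfl
  map_smul' c α := Subtype.ext <| funext fun x => by
    change extDRough (c • α.1) x = c • extDRough α.1 x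
    simp only [extDRough]
    rw [localRep_smul, extDeriv_smul]
    rfl

end Smooth
end Forms

section Operators

variable {m : ℕ} {M : Type*} [TopologicalSpace M] [ChartedSpace (Model m) M]

/-- The space `Ω*(M)` of all differential forms. Since `Ωᵏ(M) = 0` for `k > m`, the product over
all degrees is the direct sum. -/
def Forms (m : ℕ) (M : Type*) [TopologicalSpace M] [ChartedSpace (Model m) M] : Type _ :=
  (k : ℕ) → Form m M k

instance : AddCommGroup (Forms m M) := inferInstanceAs (AddCommGroup ((k : ℕ) → Form m M k))

instance : Module ℝ (Forms m M) := inferInstanceAs (Module ℝ ((k : ℕ) → Form m M k))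

/-- The element of `Ω*(M)` with given components. -/
def Forms.mk (f : (k : ℕ) → Form m M k) : Forms m M := f

/-- The component of degree `k`. -/
def Forms.comp (k : ℕ) : Forms m M →ₗ[ℝ] Form m M k where
  toFun α := α k
  map_add' _ _ := rfl
  map_smul' _ _ := rfl

@[simp] theorem Forms.comp_mk (f : (k : ℕ) → Form m M k) (k : ℕ) : Forms.comp k (Forms.mk f) = f k :=
  rfl

theorem Forms.ext {α β : Forms m M} (h : ∀ k, Forms.comp k α = Forms.comp k β) : α = β := funext h

/-- `Ωᵏ(M)` as a subspace of `Ω*(M)`, for `k ∈ ℤ`; it is zero for `k < 0`. -/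
def homog (m : ℕ) (M : Type*) [TopologicalSpace M] [ChartedSpace (Model m) M] (k : ℤ) :
    Submodule ℝ (Forms m M) where
  carrier := {α | ∀ j : ℕ, (j : ℤ) ≠ k → Forms.comp j α = 0}
  add_mem' {α β} hα hβ j hj := by rw [map_add, hα j hj, hβ j hj, add_zero]
  zero_mem' j _ := map_zero (Forms.comp j)
  smul_mem' c α hα j hj := by rw [map_smul, hα j hj, smul_zero]

/-- The Lefschetz operator `L α = ω ∧ α`. -/
def lef (ω : Form m M 2) : Forms m M →ₗ[ℝ] Forms m M where
  toFun α := Forms.mk fun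
    | 0 => 0
    | 1 => 0
    | k + 2 => wedgeTwo ω k (Forms.comp k α)
  map_add' α β := Forms.ext fun k => match k with
    | 0 => by simp
    | 1 => by simp
    | k + 2 => by simp
  map_smul' c α := Forms.ext fun k => match k with
    | 0 => by simp
    | 1 => by simp
    | k + 2 => by simp

/-- The twisted (Lichnerowicz) differential `d_l α = dα + l θ ∧ α`. -/
def lich [IsManifold (𝓡 m) (⊤ : ℕ∞) M] (θ : Form m M 1) (l : ℤ) :
    Forms m M →ₗ[ℝ] Forms m M where
  toFun α := Forms.mk fun
    | 0 => 0
    | k + 1 => extD k (Forms.comp k α) + (l : ℝ) • wedgeOne θ k (Forms.comp k α)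
  map_add' α β := Forms.ext fun k => match k with
    | 0 => by simp
    | k + 1 => by
      simp only [Forms.comp_mk, map_add, smul_add]
      abel
  map_smul' c α := Forms.ext fun k => match k with
    | 0 => by simp
    | k + 1 => by
      simp only [Forms.comp_mk, map_smul, RingHom.id_apply, smul_add]
      rw [smul_comm c (l : ℝ)]

/-- A locally conformal symplectic structure: a non-degenerate `2`-form `ω` and a closed `1`-form
`θ` with `dω = - ω ∧ θ = - θ ∧ ω`. -/
structure IsLCS [IsManifold (𝓡 m) (⊤ : ℕ∞) M] (ω : Form m M 2) (θ : Form m M 1) : Prop where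
  nondegenerate : ∀ (x : M) (v : TangentSpace (𝓡 m) x),
    (∀ w : TangentSpace (𝓡 m) x, ω.1 x ![v, w] = 0) → v = 0
  closed : extD 1 θ = 0
  d_form : extD 2 ω = - wedgeOne θ 2 ω

end Operators

section Subquotients

/-- The subquotient `A / B` of a vector space, for subspaces `B ≤ A`. -/
abbrev SubQuot {V : Type*} [AddCommGroup V] [Module ℝ V] (A B : Submodule ℝ V) : Type _ :=
  A ⧸ B.submoduleOf A

/-- The class in `A / B` of an element of `A`. -/
def SubQuot.cls {V : Type*} [AddCommGroup V] [Module ℝ V] {A B : Submodule ℝ V} (x : V)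
    (hx : x ∈ A) : SubQuot A B :=
  (B.submoduleOf A).mkQ ⟨x, hx⟩

/-- `φ : A / B → A' / B'` is the (well defined) map `[f x] ↦ [g x]`, where `x` runs through `S`:
every class in `A / B` is of the form `[f x]` with `x ∈ S`, and `φ [f x] = [g x]` for every such
`x`. In particular there is at most one such `φ`. -/
structure IsGivenBy {V : Type*} [AddCommGroup V] [Module ℝ V] {A B A' B' : Submodule ℝ V}
    (φ : SubQuot A B →ₗ[ℝ] SubQuot A' B') (S : Submodule ℝ V) (f g : V →ₗ[ℝ] V) : Prop where
  exists_rep : ∀ c : SubQuot A B, ∃ x ∈ S, ∃ h : f x ∈ A, c = SubQuot.cls (f x) h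
  map_rep : ∀ x ∈ S, ∃ (h : f x ∈ A) (h' : g x ∈ A'),
    φ (SubQuot.cls (f x) h) = SubQuot.cls (g x) h'

/-- `φ : A / B → A' / B'` is induced by the linear map `g`, i.e. `φ [x] = [g x]` for `x ∈ A`. -/
def IsInducedBy {V : Type*} [AddCommGroup V] [Module ℝ V] {A B A' B' : Submodule ℝ V}
    (φ : SubQuot A B →ₗ[ℝ] SubQuot A' B') (g : V →ₗ[ℝ] V) : Prop :=
  IsGivenBy φ A LinearMap.id g

end Subquotients

section Cohomology

variable {m n : ℕ} {M : Type*} [TopologicalSpace M]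

/-- The Lichnerowicz–Novikov cohomology `H^k_l(M) = H^k(Ω*(M), d_l)`. -/
abbrev Coh [ChartedSpace (Model m) M] [IsManifold (𝓡 m) (⊤ : ℕ∞) M] (θ : Form m M 1) (l k : ℤ) :
    Type _ :=
  SubQuot (LinearMap.ker (lich θ l) ⊓ homog m M k) ((homog m M (k - 1)).map (lich θ l))

/-- The Lefschetz filtration `F^p = L^p Ω*(M)` (with `F^p = Ω*(M)` for `p ≤ 0`). -/
def filt [ChartedSpace (Model m) M] (ω : Form m M 2) (p : ℤ) : Submodule ℝ (Forms m M) :=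
  LinearMap.range (lef ω ^ p.toNat)

/-- `Z_r^{p,q} = F^p Ω^{p+q} ∩ d_k⁻¹ (F^{p+r} Ω^{p+q+1})`. -/
def cyc [ChartedSpace (Model m) M] [IsManifold (𝓡 m) (⊤ : ℕ∞) M] (ω : Form m M 2)
    (θ : Form m M 1) (k r p q : ℤ) : Submodule ℝ (Forms m M) :=
  (filt ω p ⊓ homog m M (p + q)) ⊓ (filt ω (p + r)).comap (lich θ k)

/-- The term `E^{p,q}_{k,r}`, `r ≥ 1`, of the spectral sequence of the filtered complex
`(Ω*(M), F, d_k)`: `E_r^{p,q} = Z_r^{p,q} / (Z_{r-1}^{p+1,q-1} + d_k Z_{r-1}^{p-r+1,q+r-2})`. -/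
abbrev Page [ChartedSpace (Model m) M] [IsManifold (𝓡 m) (⊤ : ℕ∞) M] (ω : Form m M 2)
    (θ : Form m M 1) (k r p q : ℤ) : Type _ :=
  SubQuot (cyc ω θ k r p q)
    (cyc ω θ k (r - 1) (p + 1) (q - 1) ⊔
      (cyc ω θ k (r - 1) (p - r + 1) (q + r - 2)).map (lich θ k))

variable [ChartedSpace (Model (2 * n)) M]

/-- The space `𝒫^k` of primitive `k`-forms on a `2n`-dimensional manifold: forms with
`L^{n-k+1} α = 0` if `k ≤ n`, and zero if `k > n`. -/
def prim (ω : Form (2 * n) M 2) (k : ℤ) : Submodule ℝ (Forms (2 * n) M) :=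
  if k ≤ n then homog (2 * n) M k ⊓ LinearMap.ker (lef ω ^ ((n : ℤ) - k + 1).toNat) else ⊥

/-- The space `𝒫* = ⨁ 𝒫^k` of primitive forms. -/
def primTotal (ω : Form (2 * n) M 2) : Submodule ℝ (Forms (2 * n) M) := ⨆ k : ℤ, prim ω k

open Classical in
/-- The projection `Π_pr` of `Ω* = 𝒫* ⊕ L Ω*` onto `𝒫*`. For non-degenerate `ω` this decomposition
is the Lefschetz decomposition; the value `0` is a default for other `ω`. -/
def primProj (ω : Form (2 * n) M 2) : Forms (2 * n) M →ₗ[ℝ] Forms (2 * n) M :=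
  if h : IsCompl (primTotal ω) (LinearMap.range (lef ω)) then (primTotal ω).projection _ h else 0

/-- The forms of degree at most `n - 1`; for non-degenerate `ω` the operator `L` is injective
on them. -/
def lowForms (n : ℕ) (M : Type*) [TopologicalSpace M] [ChartedSpace (Model (2 * n)) M] :
    Submodule ℝ (Forms (2 * n) M) where
  carrier := {α | ∀ j : ℕ, n ≤ j → Forms.comp j α = 0}
  add_mem' {α β} hα hβ j hj := by rw [map_add, hα j hj, hβ j hj, add_zero]
  zero_mem' j _ := map_zero (Forms.comp j)
  smul_mem' c α hα j hj := by rw [map_smul, hα j hj, smul_zero]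

open Classical in
/-- A left inverse of `L` on the forms of degree at most `n - 1` (with default `0` if `L` is not
injective there). -/
def lefInv (ω : Form (2 * n) M 2) : Forms (2 * n) M →ₗ[ℝ] Forms (2 * n) M :=
  if h : ∃ T : Forms (2 * n) M →ₗ[ℝ] Forms (2 * n) M, ∀ α ∈ lowForms n M, T (lef ω α) = α
  then h.choose else 0

variable [IsManifold (𝓡 (2 * n)) (⊤ : ℕ∞) M]

/-- `d_l⁺ = Π_pr d_l`. -/
def dPlus (ω : Form (2 * n) M 2) (θ : Form (2 * n) M 1) (l : ℤ) :
    Forms (2 * n) M →ₗ[ℝ] Forms (2 * n) M :=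
  primProj ω ∘ₗ lich θ l

/-- The operator `d_l⁻` determined on forms of degree at most `n` by `d_l = d_l⁺ + L d_l⁻`. It is
used only in these degrees, where `d_l⁻ α` is the only form of degree one less than `α` with
`d_l α = d_l⁺ α + L d_l⁻ α`. -/
def dMinus (ω : Form (2 * n) M 2) (θ : Form (2 * n) M 1) (l : ℤ) :
    Forms (2 * n) M →ₗ[ℝ] Forms (2 * n) M :=
  lefInv ω ∘ₗ (lich θ l - dPlus ω θ l)

/-- `C^k_l = (ker d_l⁻ ∩ Ω^k) / d_l Ω^{k-1}`, for `0 ≤ k ≤ n`. -/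
abbrev CGroup (ω : Form (2 * n) M 2) (θ : Form (2 * n) M 1) (l k : ℤ) : Type _ :=
  SubQuot (LinearMap.ker (dMinus ω θ l) ⊓ homog (2 * n) M k)
    ((homog (2 * n) M (k - 1)).map (lich θ l))

end Cohomology

end LCS

end

/-!
Contracting `Lʳ⁺¹ α` with a vector `x` gives `ι_x Lʳ⁺¹ α = Lʳ⁺¹ ι_x α + (r + 1) (ι_x ω) ∧ Lʳ α`.
Together with Euler's identity `∑ eⁱ ∧ ι_{eᵢ} α = (deg α) α`, this shows by induction that `Lʳ` is
injective on `k`-forms whenever `k + r ≤ n`. By equality of dimensions it is bijective between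
complementary degrees, with an inverse depending smoothly on the point; this yields the Lefschetz
decomposition.

Hence every class of `E₁^{p,q}` is represented by `Lᵖ α` with `α` primitive of degree `q - p`, and
for `k = q - p` with `q ≤ n` the form `Lᵖ α`, `α ∈ Ωᵏ`, vanishes in `E₁^{p,q}` if and only if
`α ∈ L Ωᵏ⁻² + d_l Ωᵏ⁻¹`. As `d_l (Lγ) = L d_{l-1} γ`, exactness becomes a diagram chase on such
representatives.
-/

noncomputable section

namespace LCS

section AltSum

variable {V : Type*} {k : ℕ}

/-- The alternating sum `∑ (-1)ⁱ f (vᵢ) (v₀, …, v̂ᵢ, …, vₖ)` through which all exterior products are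
expressed. Working with bare functions `f` makes the identities below free of linearity side
conditions. -/
def altSum (f : V → (Fin k → V) → ℝ) (v : Fin (k + 1) → V) : ℝ :=
  ∑ i : Fin (k + 1), (-1) ^ (i : ℕ) * f (v i) (i.removeNth v)

theorem altSum_add (f g : V → (Fin k → V) → ℝ) :
    altSum (fun x => f x + g x) = altSum f + altSum g := by
  ext v; simp [altSum, mul_add, Finset.sum_add_distrib]

theorem altSum_smul (c : ℝ) (f : V → (Fin k → V) → ℝ) :
    altSum (fun x => c • f x) = c • altSum f := by
  ext v; simp [altSum, Finset.mul_sum, mul_left_comm]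

theorem altSum_neg (f : V → (Fin k → V) → ℝ) :
    altSum (fun x => -f x) = -altSum f := by
  ext v; simp [altSum]

theorem altSum_sub (f g : V → (Fin k → V) → ℝ) :
    altSum (fun x => f x - g x) = altSum f - altSum g := by
  ext v; simp [altSum, mul_sub]

theorem altSum_altSum_apply (f : V → V → (Fin k → V) → ℝ) (v : Fin (k + 2) → V) :
    altSum (fun x => altSum (f x)) v = ∑ i : Fin (k + 1), ∑ j ≥ i, (-1) ^ (i + j : ℕ) *
      (f (v i.castSucc) (v j.succ) (j.removeNth <| i.castSucc.removeNth v) -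
        f (v j.succ) (v i.castSucc) (j.removeNth <| i.castSucc.removeNth v)) := by
  simp only [altSum, Finset.mul_sum, Fin.sum_sum_eq_sum_triangle_add, Fin.val_castSucc,
    Fin.val_succ]
  refine Fintype.sum_congr _ _ fun i => Finset.sum_congr rfl fun j hij => ?_
  rw [Finset.mem_Ici] at hij
  have removeNth_lower : i.castSucc.removeNth v j = v j.succ := by
    simp [Fin.removeNth_apply, Fin.succAbove_of_le_castSucc, hij]
  have removeNth_upper : j.succ.removeNth v i = v i.castSucc := by
    simp [Fin.removeNth_apply, Fin.succAbove_of_castSucc_lt, hij]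
  have removeNth_both :
      i.removeNth (j.succ.removeNth v) = j.removeNth (i.castSucc.removeNth v) := by
    rw [Fin.removeNth_removeNth_eq_swap]
    simp [Fin.predAbove, hij, Fin.succAbove]
  rw [removeNth_lower, removeNth_upper, removeNth_both]
  ring

theorem altSum_swap (f : V → V → (Fin k → V) → ℝ) :
    altSum (fun x => altSum fun y => f x y) = -altSum (fun x => altSum fun y => f y x) := by
  ext v
  rw [Pi.neg_apply, altSum_altSum_apply f, altSum_altSum_apply fun x y => f y x]
  simp only [← Finset.sum_neg_distrib]
  exact Finset.sum_congr rfl fun i _ => Finset.sum_congr rfl fun j _ => by ring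

theorem altSum_cons (f : V → (Fin (k + 1) → V) → ℝ) (x : V) (v : Fin (k + 1) → V) :
    altSum f (Fin.cons x v) = f x v - altSum (fun y u => f y (Fin.cons x u)) v := by
  have removeNth_succ_cons (i : Fin (k + 1)) :
      i.succ.removeNth (Fin.cons x v : Fin (k + 2) → V) = Fin.cons x (i.removeNth v) := by
    ext j
    refine Fin.cases ?_ (fun j => ?_) j <;> simp [Fin.removeNth_apply]
  rw [altSum, Fin.sum_univ_succ, altSum, sub_eq_add_neg, ← Finset.sum_neg_distrib]
  congr 1
  · simp
  · refine Finset.sum_congr rfl fun i _ => ?_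
    rw [removeNth_succ_cons]
    simp [pow_succ]

theorem altSum_pair (f : V → (Fin 1 → V) → ℝ) (x y : V) :
    altSum f ![x, y] = f x ![y] - f y ![x] := by
  refine (altSum_cons f x ![y]).trans (congrArg (f x ![y] - ·) ?_)
  simp [altSum, Matrix.vecCons, Subsingleton.elim _ (Fin.elim0 (α := V))]

theorem altSum_triple (f : V → (Fin 2 → V) → ℝ) (x y z : V) :
    altSum f ![x, y, z] = f x ![y, z] - f y ![x, z] + f z ![x, y] := by
  refine (altSum_cons f x ![y, z]).trans ?_
  rw [altSum_pair]
  exact sub_sub_eq_add_sub _ _ _ |>.trans (sub_add_eq_add_sub _ _ _).symm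

end AltSum

section Wedge

variable {V : Type*} [NormedAddCommGroup V] [NormedSpace ℝ V] {k : ℕ}

theorem coe_wedgeOneL (θ : V [⋀^Fin 1]→L[ℝ] ℝ) (α : V [⋀^Fin k]→L[ℝ] ℝ) :
    ⇑(wedgeOneL V k θ α) = altSum fun x => θ ![x] • ⇑α := by
  ext v; simp [wedgeOneL_apply, altSum]

theorem coe_wedgeTwoL (ω : V [⋀^Fin 2]→L[ℝ] ℝ) (α : V [⋀^Fin k]→L[ℝ] ℝ) :
    ⇑(wedgeTwoL V k ω α) = (1 / 2 : ℝ) • altSum fun x => altSum fun y => ω ![x, y] • ⇑α := by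
  ext v; simp [wedgeTwoL_apply, altSum, Finset.mul_sum, pow_add, mul_assoc]

theorem coe_alternatizeUncurryFin (f : V →L[ℝ] V [⋀^Fin k]→L[ℝ] ℝ) :
    ⇑(ContinuousAlternatingMap.alternatizeUncurryFin f) = altSum fun x => ⇑(f x) := by
  ext v; simp [ContinuousAlternatingMap.alternatizeUncurryFin_apply, altSum]

theorem altSum_wedgeOneL (θ : V [⋀^Fin 1]→L[ℝ] ℝ) (f : V → V [⋀^Fin k]→L[ℝ] ℝ) :
    (altSum fun x => ⇑(wedgeOneL V k θ (f x))) =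
      -altSum fun x => θ ![x] • altSum fun y => ⇑(f y) := by
  simp only [coe_wedgeOneL]
  rw [altSum_swap]
  simp only [altSum_smul]

theorem altSum_wedgeTwoL (ω : V [⋀^Fin 2]→L[ℝ] ℝ) (f : V → V [⋀^Fin k]→L[ℝ] ℝ) :
    (altSum fun x => ⇑(wedgeTwoL V k ω (f x))) =
      (1 / 2 : ℝ) • altSum fun x => altSum fun y => ω ![x, y] • altSum fun z => ⇑(f z) := by
  simp only [coe_wedgeTwoL, altSum_smul]
  rw [altSum_swap]
  conv_lhs =>
    enter [2, 1, 1, x]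
    rw [altSum_swap]
  simp only [altSum_smul, altSum_neg, neg_neg]

theorem wedgeOneL_anticomm (θ η : V [⋀^Fin 1]→L[ℝ] ℝ) (α : V [⋀^Fin k]→L[ℝ] ℝ) :
    wedgeOneL V _ θ (wedgeOneL V _ η α) = -wedgeOneL V _ η (wedgeOneL V _ θ α) := by
  apply DFunLike.coe_injective
  rw [coe_wedgeOneL, ContinuousAlternatingMap.coe_neg, coe_wedgeOneL η, coe_wedgeOneL η,
    coe_wedgeOneL θ]
  simp only [← altSum_smul]
  rw [altSum_swap]
  simp only [smul_comm (η _) (θ _)]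

theorem wedgeOneL_wedgeOneL_self (θ : V [⋀^Fin 1]→L[ℝ] ℝ) (α : V [⋀^Fin k]→L[ℝ] ℝ) :
    wedgeOneL V _ θ (wedgeOneL V _ θ α) = 0 :=
  DFunLike.coe_injective <| self_eq_neg.1 <| congrArg DFunLike.coe <| wedgeOneL_anticomm θ θ α

theorem wedgeOneL_wedgeTwoL (θ : V [⋀^Fin 1]→L[ℝ] ℝ) (ω : V [⋀^Fin 2]→L[ℝ] ℝ)
    (α : V [⋀^Fin k]→L[ℝ] ℝ) :
    wedgeOneL V _ θ (wedgeTwoL V _ ω α) = wedgeTwoL V _ ω (wedgeOneL V _ θ α) := by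
  apply DFunLike.coe_injective
  have swap_wedge := altSum_wedgeTwoL ω fun x => θ ![x] • α
  simp only [map_smul, ContinuousAlternatingMap.coe_smul] at swap_wedge
  rw [coe_wedgeOneL, swap_wedge, coe_wedgeTwoL, coe_wedgeOneL]

theorem altSum_wedgeOneL_eq_zero {T : V → V [⋀^Fin 1]→L[ℝ] ℝ}
    (hT : (altSum fun x => ⇑(T x)) = 0) (α : V [⋀^Fin k]→L[ℝ] ℝ) :
    (altSum fun x => ⇑(wedgeOneL V k (T x) α)) = 0 := by
  have symm (x y : V) : T x ![y] = T y ![x] := by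
    have hT_xy := congrFun hT ![x, y]
    rw [altSum_pair, Pi.zero_apply] at hT_xy
    linarith
  simp only [coe_wedgeOneL]
  refine self_eq_neg.1 ((altSum_swap _).trans ?_)
  simp only [symm]

theorem altSum_wedgeTwoL_eq_zero {T : V → V [⋀^Fin 2]→L[ℝ] ℝ}
    (hT : (altSum fun x => ⇑(T x)) = 0) (α : V [⋀^Fin k]→L[ℝ] ℝ) :
    (altSum fun x => ⇑(wedgeTwoL V k (T x) α)) = 0 := by
  have cyclic (x y z : V) : T z ![x, y] = T y ![x, z] - T x ![y, z] := by
    have hT_xyz := congrFun hT ![x, y, z]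
    rw [altSum_triple, Pi.zero_apply] at hT_xyz
    linarith
  simp only [coe_wedgeTwoL, altSum_smul]
  set X := altSum fun x => altSum fun y => altSum fun z => T x ![y, z] • ⇑α with hX
  have swap_outer : (altSum fun x => altSum fun y => altSum fun z => T y ![x, z] • ⇑α) = -X :=
    altSum_swap _
  have rotate : (altSum fun x => altSum fun y => altSum fun z => T z ![x, y] • ⇑α) = X := by
    rw [hX, altSum_swap fun x y => altSum fun z => T x ![y, z] • ⇑α, ← altSum_neg]
    congr 1
    ext x : 1
    rw [altSum_swap]
  have X_eq : X = -X - X :=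
    calc X = altSum fun x => altSum fun y => altSum fun z => T z ![x, y] • ⇑α := rotate.symm
      _ = -X - X := by
        rw [← swap_outer, hX, ← altSum_sub]
        simp only [← altSum_sub, ← sub_smul, ← cyclic]
  have three_smul_X : (3 : ℝ) • X = 0 := by linear_combination (norm := module) X_eq
  rw [(smul_eq_zero.1 three_smul_X).resolve_left three_ne_zero, smul_zero]

end Wedge

section Graded

variable {V : Type*} [NormedAddCommGroup V] [NormedSpace ℝ V]

/-- A `2`-form on a vector space is non-degenerate if its kernel is trivial. -/
def IsNondegenerate (ω : V [⋀^Fin 2]→L[ℝ] ℝ) : Prop :=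
  ∀ v, (∀ w, ω ![v, w] = 0) → v = 0

theorem IsNondegenerate.exists_forall_eq [FiniteDimensional ℝ V] {ω : V [⋀^Fin 2]→L[ℝ] ℝ}
    (hω : IsNondegenerate ω) (φ : Module.Dual ℝ V) : ∃ v, ∀ w, ω.curryLeft v ![w] = φ w := by
  let T : V →ₗ[ℝ] Module.Dual ℝ V :=
    { toFun v := (((ContinuousAlternatingMap.ofSubsingletonLIE (𝕜 := ℝ) (E := V) (F := ℝ)
        (0 : Fin 1)).symm (ω.curryLeft v) : V →L[ℝ] ℝ) : V →ₗ[ℝ] ℝ)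
      map_add' v v' := by ext; simp
      map_smul' c v := by ext; simp }
  have T_apply (v w : V) : T v w = ω.curryLeft v ![w] :=
    congrArg (ω.curryLeft v) (Matrix.vec_single_eq_const w).symm
  have T_injective : Function.Injective T := (injective_iff_map_eq_zero T).2 fun v hv =>
    hω v fun w => (T_apply v w).symm.trans (LinearMap.congr_fun hv w)
  have T_surjective : Function.Surjective T :=
    (LinearMap.injective_iff_surjective_of_finrank_eq_finrank
      Subspace.dual_finrank_eq.symm).1 T_injective
  obtain ⟨v, rfl⟩ := T_surjective φ
  exact ⟨v, fun w => (T_apply v w).symm⟩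

theorem twoForm_swap (ω : V [⋀^Fin 2]→L[ℝ] ℝ) (x y : V) : ω ![x, y] = -ω ![y, x] := by
  refine Eq.trans (congrArg ω ?_) (ω.map_swap ![y, x] (i := 0) (j := 1) (by decide))
  ext i; fin_cases i <;> simp

theorem coe_wedgeTwoL_eq_altSum_wedgeOneL {k : ℕ} (ω : V [⋀^Fin 2]→L[ℝ] ℝ)
    (α : V [⋀^Fin k]→L[ℝ] ℝ) :
    ⇑(wedgeTwoL V k ω α) = (1 / 2 : ℝ) • altSum fun x => ⇑(wedgeOneL V k (ω.curryLeft x) α) := by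
  rw [coe_wedgeTwoL]
  simp only [coe_wedgeOneL, ContinuousAlternatingMap.curryLeft_apply_apply]

theorem altSum_curryLeft_flip {k : ℕ} (ω : V [⋀^Fin 2]→L[ℝ] ℝ) (α : V [⋀^Fin k]→L[ℝ] ℝ)
    (x : V) : (altSum fun y => ω.curryLeft y ![x] • ⇑α) =
      -⇑(wedgeOneL V k (ω.curryLeft x) α) := by
  rw [coe_wedgeOneL, ← altSum_neg]
  simp only [ContinuousAlternatingMap.curryLeft_apply_apply, twoForm_swap ω _ x, neg_smul]

theorem curryLeft_wedgeOneL_zero (θ : V [⋀^Fin 1]→L[ℝ] ℝ) (α : V [⋀^Fin 0]→L[ℝ] ℝ) (x : V) :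
    (wedgeOneL V 0 θ α).curryLeft x = θ ![x] • α := by
  ext v
  change wedgeOneL V 0 θ α (Fin.cons x v) = _
  rw [coe_wedgeOneL, altSum, Fin.sum_univ_succ]
  simp

theorem curryLeft_wedgeOneL {k : ℕ} (θ : V [⋀^Fin 1]→L[ℝ] ℝ) (α : V [⋀^Fin (k + 1)]→L[ℝ] ℝ)
    (x : V) :
    (wedgeOneL V (k + 1) θ α).curryLeft x = θ ![x] • α - wedgeOneL V k θ (α.curryLeft x) := by
  ext v
  change wedgeOneL V (k + 1) θ α (Fin.cons x v) = (θ ![x] • α) v - wedgeOneL V k θ (α.curryLeft x) v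
  rw [coe_wedgeOneL, altSum_cons, coe_wedgeOneL]
  rfl

theorem curryLeft_wedgeTwoL_zero (ω : V [⋀^Fin 2]→L[ℝ] ℝ) (α : V [⋀^Fin 0]→L[ℝ] ℝ) (x : V) :
    (wedgeTwoL V 0 ω α).curryLeft x = wedgeOneL V 0 (ω.curryLeft x) α := by
  ext v
  change wedgeTwoL V 0 ω α (Fin.cons x v) = _
  have contract_inner : (fun y (u : Fin 0 → V) => wedgeOneL V 0 (ω.curryLeft y) α (Fin.cons x u)) =
      fun y => ω.curryLeft y ![x] • ⇑α :=
    funext fun y => congrArg DFunLike.coe (curryLeft_wedgeOneL_zero (ω.curryLeft y) α x)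
  rw [coe_wedgeTwoL_eq_altSum_wedgeOneL, Pi.smul_apply, altSum_cons, contract_inner,
    altSum_curryLeft_flip, Pi.neg_apply, smul_eq_mul]
  ring

theorem curryLeft_wedgeTwoL {k : ℕ} (ω : V [⋀^Fin 2]→L[ℝ] ℝ) (α : V [⋀^Fin (k + 1)]→L[ℝ] ℝ)
    (x : V) : (wedgeTwoL V (k + 1) ω α).curryLeft x =
      wedgeOneL V (k + 1) (ω.curryLeft x) α + wedgeTwoL V k ω (α.curryLeft x) := by
  ext v
  change wedgeTwoL V (k + 1) ω α (Fin.cons x v) =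
    wedgeOneL V (k + 1) (ω.curryLeft x) α v + wedgeTwoL V k ω (α.curryLeft x) v
  have contract_inner : (fun y (u : Fin (k + 1) → V) =>
      wedgeOneL V (k + 1) (ω.curryLeft y) α (Fin.cons x u)) =
      fun y => ω.curryLeft y ![x] • ⇑α - ⇑(wedgeOneL V k (ω.curryLeft y) (α.curryLeft x)) :=
    funext fun y => congrArg DFunLike.coe (curryLeft_wedgeOneL (ω.curryLeft y) α x)
  rw [coe_wedgeTwoL_eq_altSum_wedgeOneL, coe_wedgeTwoL_eq_altSum_wedgeOneL, Pi.smul_apply,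
    altSum_cons, contract_inner, altSum_sub, altSum_curryLeft_flip, Pi.sub_apply, Pi.neg_apply,
    Pi.smul_apply, smul_eq_mul, smul_eq_mul]
  ring

/-- The exterior algebra of alternating forms on a vector space, as the product of its graded
pieces. -/
abbrev GradedForms (V : Type*) [NormedAddCommGroup V] [NormedSpace ℝ V] : Type _ :=
  (k : ℕ) → V [⋀^Fin k]→L[ℝ] ℝ

namespace GradedForms

/-- All components of `α` outside degree `k` vanish. -/
def IsHomogeneous (α : GradedForms V) (k : ℕ) : Prop := ∀ j, j ≠ k → α j = 0

/-- The linear model of the Lefschetz operator, `α ↦ ω ∧ α`. -/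
def lef (ω : V [⋀^Fin 2]→L[ℝ] ℝ) : GradedForms V →ₗ[ℝ] GradedForms V where
  toFun α := fun
    | 0 => 0
    | 1 => 0
    | k + 2 => wedgeTwoL V k ω (α k)
  map_add' α β := funext fun k => match k with
    | 0 => by simp
    | 1 => by simp
    | k + 2 => by simp
  map_smul' c α := funext fun k => match k with
    | 0 => by simp
    | 1 => by simp
    | k + 2 => by simp

/-- Exterior multiplication by a covector, `α ↦ θ ∧ α`. -/
def wedge (θ : V [⋀^Fin 1]→L[ℝ] ℝ) : GradedForms V →ₗ[ℝ] GradedForms V where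
  toFun α := fun
    | 0 => 0
    | k + 1 => wedgeOneL V k θ (α k)
  map_add' α β := funext fun k => match k with
    | 0 => by simp
    | k + 1 => by simp
  map_smul' c α := funext fun k => match k with
    | 0 => by simp
    | k + 1 => by simp

/-- The interior product `ι_x α = α(x, ·, …, ·)`. -/
def contract (x : V) : GradedForms V →ₗ[ℝ] GradedForms V where
  toFun α k := (α (k + 1)).curryLeft x
  map_add' _ _ := rfl
  map_smul' _ _ := rfl

theorem IsHomogeneous.eq_zero {α : GradedForms V} {k : ℕ} (hα : α.IsHomogeneous k)
    (hk : α k = 0) : α = 0 :=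
  funext fun j => if hj : j = k then hj ▸ hk else hα j hj

theorem IsHomogeneous.contract {α : GradedForms V} {k : ℕ} (hα : α.IsHomogeneous (k + 1))
    (x : V) : (contract x α).IsHomogeneous k := fun j hj => by
  change (α (j + 1)).curryLeft x = 0
  rw [hα (j + 1) (by omega)]
  rfl

theorem IsHomogeneous.contract_eq_zero {α : GradedForms V} (hα : α.IsHomogeneous 0) (x : V) :
    GradedForms.contract x α = 0 := funext fun j => by
  change (α (j + 1)).curryLeft x = 0
  rw [hα (j + 1) (by omega)]
  rfl

theorem IsHomogeneous.lef_pow {α : GradedForms V} {k : ℕ} (hα : α.IsHomogeneous k)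
    (ω : V [⋀^Fin 2]→L[ℝ] ℝ) (r : ℕ) : ((lef ω ^ r) α).IsHomogeneous (k + 2 * r) := by
  induction r with
  | zero => exact hα
  | succ r ih =>
    rw [pow_succ']
    intro j hj
    match j with
    | 0 => rfl
    | 1 => rfl
    | j + 2 =>
      change wedgeTwoL V j ω ((lef ω ^ r) α j) = 0
      rw [ih j (by omega), map_zero]

theorem eq_zero_of_contract_eq_zero {α : GradedForms V} (h₀ : α 0 = 0)
    (hα : ∀ x, contract x α = 0) : α = 0 := by
  funext k
  cases k with
  | zero => exact h₀
  | succ k =>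
    ext v
    have contract_apply : (α (k + 1)).curryLeft (v 0) (Fin.tail v) = 0 :=
      congrArg (· k (Fin.tail v)) (hα (v 0))
    rwa [ContinuousAlternatingMap.curryLeft_apply_apply, Matrix.vecCons,
      Fin.cons_self_tail] at contract_apply

theorem contract_wedge (x : V) (θ : V [⋀^Fin 1]→L[ℝ] ℝ) (α : GradedForms V) :
    contract x (wedge θ α) = θ ![x] • α - wedge θ (contract x α) := by
  funext k
  cases k with
  | zero => exact (curryLeft_wedgeOneL_zero θ (α 0) x).trans (sub_zero _).symm
  | succ k => exact curryLeft_wedgeOneL θ (α (k + 1)) x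

theorem contract_lef (x : V) (ω : V [⋀^Fin 2]→L[ℝ] ℝ) (α : GradedForms V) :
    contract x (lef ω α) = wedge (ω.curryLeft x) α + lef ω (contract x α) := by
  funext k
  match k with
  | 0 => exact (add_zero _).symm
  | 1 => exact (curryLeft_wedgeTwoL_zero ω (α 0) x).trans (add_zero _).symm
  | k + 2 => exact curryLeft_wedgeTwoL ω (α (k + 1)) x

theorem wedge_lef (θ : V [⋀^Fin 1]→L[ℝ] ℝ) (ω : V [⋀^Fin 2]→L[ℝ] ℝ) (α : GradedForms V) :
    wedge θ (lef ω α) = lef ω (wedge θ α) := by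
  funext k
  match k with
  | 0 => rfl
  | 1 => exact map_zero (wedgeOneL V 0 θ)
  | 2 => exact (map_zero (wedgeOneL V 1 θ)).trans (map_zero (wedgeTwoL V 0 ω)).symm
  | k + 3 => exact wedgeOneL_wedgeTwoL θ ω (α k)

theorem contract_lef_pow (x : V) (ω : V [⋀^Fin 2]→L[ℝ] ℝ) (r : ℕ) (α : GradedForms V) :
    contract x ((lef ω ^ (r + 1)) α) = (lef ω ^ (r + 1)) (contract x α) +
      ((r : ℝ) + 1) • wedge (ω.curryLeft x) ((lef ω ^ r) α) := by
  induction r with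
  | zero => simp [contract_lef, add_comm]
  | succ r ih =>
    rw [pow_succ', Module.End.mul_apply, contract_lef, ih, map_add, map_smul, ← wedge_lef,
      Module.End.mul_apply, ← Module.End.mul_apply (lef ω) (lef ω ^ r), ← pow_succ']
    push_cast
    module

theorem sum_wedge_contract {ι : Type*} [Fintype ι] (b : Module.Basis ι ℝ V)
    {ξ : ι → V [⋀^Fin 1]→L[ℝ] ℝ} (hξ : ∀ i w, ξ i ![w] = b.coord i w) (α : GradedForms V)
    (k : ℕ) : (∑ i, wedge (ξ i) (contract (b i) α)) k = k • α k := by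
  rw [Finset.sum_apply]
  cases k with
  | zero => simp [wedge]
  | succ k =>
    change ∑ i, wedgeOneL V k (ξ i) ((α (k + 1)).curryLeft (b i)) = _
    rw [← ContinuousAlternatingMap.alternatizeUncurryFin_curryLeft]
    apply DFunLike.coe_injective
    funext v
    rw [coe_alternatizeUncurryFin, ContinuousAlternatingMap.sum_apply]
    simp only [coe_wedgeOneL, altSum, hξ, Pi.smul_apply, smul_eq_mul]
    rw [Finset.sum_comm]
    refine Finset.sum_congr rfl fun i _ => ?_
    rw [← Finset.mul_sum]
    congr 1
    conv_rhs => rw [← b.sum_repr (v i), map_sum, ContinuousAlternatingMap.sum_apply]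
    simp

theorem eq_zero_of_wedge_curryLeft_eq_zero [FiniteDimensional ℝ V] {ω : V [⋀^Fin 2]→L[ℝ] ℝ}
    (hω : IsNondegenerate ω) {k : ℕ} (hk : k ≠ Module.finrank ℝ V) {β : GradedForms V}
    (hβ : β.IsHomogeneous k) (h : ∀ x, wedge (ω.curryLeft x) β = 0) : β = 0 := by
  let b := Module.finBasis ℝ V
  choose e he using fun i => hω.exists_forall_eq (b.coord i)
  have wedge_contract_eq (i) : wedge (ω.curryLeft (e i)) (contract (b i) β) = β := by
    have wedge_eq := contract_wedge (b i) (ω.curryLeft (e i)) β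
    rw [h, map_zero, he, Module.Basis.coord_apply, Module.Basis.repr_self,
      Finsupp.single_eq_same, one_smul] at wedge_eq
    exact (sub_eq_zero.1 wedge_eq.symm).symm
  have euler : Module.finrank ℝ V • β k = k • β k := by
    simpa [wedge_contract_eq] using sum_wedge_contract b he β k
  refine hβ.eq_zero ?_
  rw [← Nat.cast_smul_eq_nsmul ℝ, ← Nat.cast_smul_eq_nsmul ℝ, ← sub_eq_zero, ← sub_smul] at euler
  exact (smul_eq_zero.1 euler).resolve_left (sub_ne_zero.2 (by exact_mod_cast hk.symm))

/-- Hard Lefschetz: the induction on the degree contracts `Lʳ α = 0`, which gives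
`Lʳ⁺¹ (ι_x α) = 0`; in degree `0` one descends on the power `r` instead. -/
theorem eq_zero_of_lef_pow_eq_zero [FiniteDimensional ℝ V] {ω : V [⋀^Fin 2]→L[ℝ] ℝ}
    (hω : IsNondegenerate ω) {k r : ℕ} (hkr : 2 * (k + r) ≤ Module.finrank ℝ V)
    {α : GradedForms V} (hα : α.IsHomogeneous k) (h : (lef ω ^ r) α = 0) : α = 0 := by
  induction k generalizing r α with
  | zero =>
    induction r with
    | zero => exact h
    | succ r ih =>
      refine ih (by omega) (eq_zero_of_wedge_curryLeft_eq_zero hω (k := 0 + 2 * r) (by omega)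
        (hα.lef_pow ω r) fun x => ?_)
      have smul_wedge_eq_zero := contract_lef_pow x ω r α
      rw [h, hα.contract_eq_zero, map_zero, map_zero, zero_add] at smul_wedge_eq_zero
      exact (smul_eq_zero.1 smul_wedge_eq_zero.symm).resolve_left (by positivity)
  | succ k ih =>
    refine eq_zero_of_contract_eq_zero (hα 0 (by omega)) fun x =>
      ih (r := r + 1) (by omega) (hα.contract x) ?_
    simpa [pow_succ' _ r, h] using (contract_lef_pow x ω r α).symm

end GradedForms

end Graded

section Dimension

variable {V : Type*} [NormedAddCommGroup V] [NormedSpace ℝ V] [FiniteDimensional ℝ V]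

theorem continuous_multilinearMap {ι : Type*} [Finite ι]
    (f : MultilinearMap ℝ (fun _ : ι => V) ℝ) : Continuous f := by
  classical
  cases nonempty_fintype ι
  let b := Module.finBasis ℝ V
  have expansion (v : ι → V) : f v = ∑ r : ι → Fin (Module.finrank ℝ V),
      (∏ i, b.coord (r i) (v i)) • f fun i => b (r i) := by
    conv_lhs => rw [← funext fun i => b.sum_repr (v i), MultilinearMap.map_sum]
    exact Finset.sum_congr rfl fun r _ => MultilinearMap.map_smul_univ ..
  rw [funext expansion]
  have continuous_coord (i : ι) (j : Fin (Module.finrank ℝ V)) :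
      Continuous fun v : ι → V => b.coord j (v i) :=
    (b.coord j).continuous_of_finiteDimensional.comp (continuous_apply i)
  fun_prop

/-- In finite dimension, all alternating maps are continuous. -/
def continuousAlternatingMapEquiv (V : Type*) [NormedAddCommGroup V] [NormedSpace ℝ V]
    [FiniteDimensional ℝ V] (k : ℕ) : (V [⋀^Fin k]→L[ℝ] ℝ) ≃ₗ[ℝ] (V [⋀^Fin k]→ₗ[ℝ] ℝ) :=
  LinearEquiv.ofBijective ContinuousAlternatingMap.toAlternatingMapLinear
    ⟨ContinuousAlternatingMap.toAlternatingMap_injective, fun f =>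
      ⟨{ f with cont := continuous_multilinearMap f.toMultilinearMap }, rfl⟩⟩

instance finiteDimensional_continuousAlternatingMap (k : ℕ) :
    FiniteDimensional ℝ (V [⋀^Fin k]→L[ℝ] ℝ) :=
  Module.Finite.equiv ((continuousAlternatingMapEquiv V k).trans
    exteriorPower.alternatingMapLinearEquiv).symm

theorem finrank_continuousAlternatingMap (k : ℕ) :
    Module.finrank ℝ (V [⋀^Fin k]→L[ℝ] ℝ) = (Module.finrank ℝ V).choose k := by
  rw [((continuousAlternatingMapEquiv V k).trans
    exteriorPower.alternatingMapLinearEquiv).finrank_eq, ← exteriorPower.finrank_eq (R := ℝ)]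
  exact Subspace.dual_finrank_eq

end Dimension

section Leibniz

variable {V : Type*} [NormedAddCommGroup V] [NormedSpace ℝ V] {k : ℕ}

theorem coe_extDeriv (α : V → V [⋀^Fin k]→L[ℝ] ℝ) (y : V) :
    ⇑(extDeriv α y) = altSum fun x => ⇑(fderiv ℝ α y x) :=
  coe_alternatizeUncurryFin _

theorem extDeriv_wedgeOneL {θ : V → V [⋀^Fin 1]→L[ℝ] ℝ} {α : V → V [⋀^Fin k]→L[ℝ] ℝ} {y : V}
    (hθ : DifferentiableAt ℝ θ y) (hα : DifferentiableAt ℝ α y) (hdθ : extDeriv θ y = 0) :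
    extDeriv (fun z => wedgeOneL V k (θ z) (α z)) y =
      -wedgeOneL V (k + 1) (θ y) (extDeriv α y) := by
  have product_rule := (wedgeOneL V k).hasFDerivAt_of_bilinear hθ.hasFDerivAt hα.hasFDerivAt
  have altSum_fderiv : (altSum fun x => ⇑(fderiv ℝ θ y x)) = 0 := by
    rw [← coe_extDeriv, hdθ]; rfl
  apply DFunLike.coe_injective
  calc ⇑(extDeriv (fun z => wedgeOneL V k (θ z) (α z)) y)
    _ = altSum fun x => ⇑(wedgeOneL V k (θ y) (fderiv ℝ α y x)) +
          ⇑(wedgeOneL V k (fderiv ℝ θ y x) (α y)) := by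
      rw [coe_extDeriv, product_rule.fderiv]; rfl
    _ = altSum fun x => ⇑(wedgeOneL V k (θ y) (fderiv ℝ α y x)) := by
      rw [altSum_add, altSum_wedgeOneL_eq_zero altSum_fderiv, add_zero]
    _ = ⇑(-wedgeOneL V (k + 1) (θ y) (extDeriv α y)) := by
      rw [altSum_wedgeOneL, ContinuousAlternatingMap.coe_neg, coe_wedgeOneL, coe_extDeriv]

theorem extDeriv_wedgeTwoL {ω : V → V [⋀^Fin 2]→L[ℝ] ℝ} {θ : V [⋀^Fin 1]→L[ℝ] ℝ}
    {α : V → V [⋀^Fin k]→L[ℝ] ℝ} {y : V}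
    (hω : DifferentiableAt ℝ ω y) (hα : DifferentiableAt ℝ α y)
    (hdω : extDeriv ω y = -wedgeOneL V 2 θ (ω y)) :
    extDeriv (fun z => wedgeTwoL V k (ω z) (α z)) y =
      wedgeTwoL V (k + 1) (ω y) (extDeriv α y) -
        wedgeOneL V (k + 2) θ (wedgeTwoL V k (ω y) (α y)) := by
  have product_rule := (wedgeTwoL V k).hasFDerivAt_of_bilinear hω.hasFDerivAt hα.hasFDerivAt
  have altSum_twisted : (altSum fun x => ⇑(fderiv ℝ ω y x + θ ![x] • ω y)) = 0 := by
    simp only [ContinuousAlternatingMap.coe_add, ContinuousAlternatingMap.coe_smul]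
    rw [altSum_add, ← coe_extDeriv, ← coe_wedgeOneL, hdω, ContinuousAlternatingMap.coe_neg,
      neg_add_cancel]
  have altSum_fderiv_wedge : (altSum fun x => ⇑(wedgeTwoL V k (fderiv ℝ ω y x) (α y))) =
      -⇑(wedgeOneL V (k + 2) θ (wedgeTwoL V k (ω y) (α y))) := by
    have alternating := altSum_wedgeTwoL_eq_zero altSum_twisted (α y)
    simp only [map_add, map_smul, add_apply, smul_apply,
      ContinuousAlternatingMap.coe_add, ContinuousAlternatingMap.coe_smul] at alternating
    rwa [altSum_add, ← coe_wedgeOneL, add_eq_zero_iff_eq_neg] at alternating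
  apply DFunLike.coe_injective
  calc ⇑(extDeriv (fun z => wedgeTwoL V k (ω z) (α z)) y)
    _ = altSum fun x => ⇑(wedgeTwoL V k (ω y) (fderiv ℝ α y x)) +
          ⇑(wedgeTwoL V k (fderiv ℝ ω y x) (α y)) := by
      rw [coe_extDeriv, product_rule.fderiv]; rfl
    _ = ⇑(wedgeTwoL V (k + 1) (ω y) (extDeriv α y) -
          wedgeOneL V (k + 2) θ (wedgeTwoL V k (ω y) (α y))) := by
      rw [altSum_add, altSum_fderiv_wedge, altSum_wedgeTwoL, ContinuousAlternatingMap.coe_sub,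
        coe_wedgeTwoL _ (extDeriv α y), coe_extDeriv, sub_eq_add_neg]

end Leibniz

section Manifold

variable {m : ℕ} {M : Type*} [TopologicalSpace M] [ChartedSpace (Model m) M]
  {e : OpenPartialHomeomorph M (Model m)} {k : ℕ}

theorem localRep_wedgeOne (θ : Form m M 1) (α : Form m M k) (y : Model m) :
    localRep e (wedgeOne θ k α).1 y =
      wedgeOneL (Model m) k (localRep e θ.1 y) (localRep e α.1 y) :=
  wedgeOneL_comp (V := Model m) (W := Model m) (θ.1 (e.symm y)) (α.1 (e.symm y)) _

theorem localRep_wedgeTwo (ω : Form m M 2) (α : Form m M k) (y : Model m) :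
    localRep e (wedgeTwo ω k α).1 y =
      wedgeTwoL (Model m) k (localRep e ω.1 y) (localRep e α.1 y) :=
  wedgeTwoL_comp (V := Model m) (W := Model m) (ω.1 (e.symm y)) (α.1 (e.symm y)) _

theorem IsSmooth.contDiffAt_localRep {α : RoughForm m M k} (hα : IsSmooth α)
    (he : e ∈ atlas (Model m) M) {y : Model m} (hy : y ∈ e.target) :
    ContDiffAt ℝ (⊤ : ℕ∞) (localRep e α) y :=
  (hα e he).contDiffAt (e.open_target.mem_nhds hy)

theorem IsSmooth.differentiableAt_localRep {α : RoughForm m M k} (hα : IsSmooth α)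
    (he : e ∈ atlas (Model m) M) {y : Model m} (hy : y ∈ e.target) :
    DifferentiableAt ℝ (localRep e α) y :=
  (hα.contDiffAt_localRep he hy).differentiableAt (by simp)

theorem wedgeOne_wedgeOne_self (θ : Form m M 1) (α : Form m M k) :
    wedgeOne θ (k + 1) (wedgeOne θ k α) = 0 :=
  Subtype.ext <| funext fun x => wedgeOneL_wedgeOneL_self (V := Model m) (θ.1 x) (α.1 x)

theorem wedgeOne_wedgeTwo (θ : Form m M 1) (ω : Form m M 2) (α : Form m M k) :
    wedgeOne θ (k + 2) (wedgeTwo ω k α) = wedgeTwo ω (k + 1) (wedgeOne θ k α) :=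
  Subtype.ext <| funext fun x => wedgeOneL_wedgeTwoL (V := Model m) (θ.1 x) (ω.1 x) (α.1 x)

theorem comp_lef_zero (ω : Form m M 2) (α : Forms m M) : Forms.comp 0 (lef ω α) = 0 := rfl

theorem comp_lef_one (ω : Form m M 2) (α : Forms m M) : Forms.comp 1 (lef ω α) = 0 := rfl

theorem comp_lef_add_two (ω : Form m M 2) (α : Forms m M) (k : ℕ) :
    Forms.comp (k + 2) (lef ω α) = wedgeTwo ω k (Forms.comp k α) := rfl

variable [IsManifold (𝓡 m) (⊤ : ℕ∞) M]

theorem comp_lich_zero (θ : Form m M 1) (l : ℤ) (α : Forms m M) :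
    Forms.comp 0 (lich θ l α) = 0 := rfl

theorem comp_lich_succ (θ : Form m M 1) (l : ℤ) (α : Forms m M) (k : ℕ) :
    Forms.comp (k + 1) (lich θ l α) =
      extD k (Forms.comp k α) + (l : ℝ) • wedgeOne θ k (Forms.comp k α) := rfl

theorem localRep_extD (α : Form m M k) (he : e ∈ atlas (Model m) M) {y : Model m}
    (hy : y ∈ e.target) : localRep e (extD k α).1 y = extDeriv (localRep e α.1) y :=
  localRep_extDRough α.2 he hy

theorem mfderiv_symm_bijective (he : e ∈ atlas (Model m) M) {y : Model m} (hy : y ∈ e.target) :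
    Function.Bijective (mfderiv (𝓡 m) (𝓡 m) e.symm y) := by
  have : IsManifold (𝓡 m) 1 M := IsManifold.of_le (n := (⊤ : ℕ∞)) (by exact_mod_cast le_top)
  exact (mdifferentiable_of_mem_atlas he).symm.mfderiv_bijective hy

theorem RoughForm.ext_localRep {α β : RoughForm m M k}
    (h : ∀ e ∈ atlas (Model m) M, ∀ y ∈ e.target, localRep e α y = localRep e β y) : α = β := by
  funext x
  set e := chartAt (Model m) x
  have he : e ∈ atlas (Model m) M := chart_mem_atlas _ x
  have hy : e x ∈ e.target := mem_chart_target _ x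
  suffices eq_symm_apply : α (e.symm (e x)) = β (e.symm (e x)) by
    rwa [show e.symm (e x) = x from e.left_inv (mem_chart_source _ x)] at eq_symm_apply
  ext v
  choose w hw using fun i => (mfderiv_symm_bijective he hy).2 (v i)
  rw [← funext hw]
  exact congrArg (· w) (h e he _ hy)

theorem Form.ext_localRep {α β : Form m M k}
    (h : ∀ e ∈ atlas (Model m) M, ∀ y ∈ e.target, localRep e α.1 y = localRep e β.1 y) : α = β :=
  Subtype.ext (RoughForm.ext_localRep h)

theorem extD_extD (α : Form m M k) : extD (k + 1) (extD k α) = 0 := by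
  refine Form.ext_localRep fun e he y hy => ?_
  have localRep_eventuallyEq : localRep e (extD k α).1 =ᶠ[𝓝 y] extDeriv (localRep e α.1) := by
    filter_upwards [e.open_target.mem_nhds hy] with z hz using localRep_extD α he hz
  rw [localRep_extD _ he hy, localRep_eventuallyEq.extDeriv_eq,
    extDeriv_extDeriv_apply (α.2.contDiffAt_localRep he hy)]
  · rfl
  · rw [minSmoothness_of_isRCLikeNormedField]
    exact WithTop.coe_le_coe.2 le_top

theorem extD_wedgeOne {θ : Form m M 1} (hθ : extD 1 θ = 0) (α : Form m M k) :
    extD (k + 1) (wedgeOne θ k α) = -wedgeOne θ (k + 1) (extD k α) := by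
  refine Form.ext_localRep fun e he y hy => ?_
  have extDeriv_localRep : extDeriv (localRep e θ.1) y = 0 := by
    rw [← localRep_extD θ he hy, hθ]; rfl
  calc localRep e (extD (k + 1) (wedgeOne θ k α)).1 y
    _ = -wedgeOneL (Model m) (k + 1) (localRep e θ.1 y) (localRep e (extD k α).1 y) := by
      rw [localRep_extD _ he hy, funext (localRep_wedgeOne (e := e) θ α), localRep_extD α he hy,
        extDeriv_wedgeOneL (θ.2.differentiableAt_localRep he hy)
          (α.2.differentiableAt_localRep he hy) extDeriv_localRep]
    _ = localRep e (-wedgeOne θ (k + 1) (extD k α)).1 y :=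
      congrArg Neg.neg (localRep_wedgeOne θ (extD k α) y).symm

theorem extD_wedgeTwo {ω : Form m M 2} {θ : Form m M 1}
    (hω : extD 2 ω = -wedgeOne θ 2 ω) (α : Form m M k) :
    extD (k + 2) (wedgeTwo ω k α) =
      wedgeTwo ω (k + 1) (extD k α) - wedgeOne θ (k + 2) (wedgeTwo ω k α) := by
  refine Form.ext_localRep fun e he y hy => ?_
  have extDeriv_localRep : extDeriv (localRep e ω.1) y =
      -wedgeOneL (Model m) 2 (localRep e θ.1 y) (localRep e ω.1 y) := by
    rw [← localRep_extD ω he hy, hω]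
    exact congrArg Neg.neg (localRep_wedgeOne θ ω y)
  calc localRep e (extD (k + 2) (wedgeTwo ω k α)).1 y
    _ = wedgeTwoL (Model m) (k + 1) (localRep e ω.1 y) (localRep e (extD k α).1 y) -
          wedgeOneL (Model m) (k + 2) (localRep e θ.1 y) (localRep e (wedgeTwo ω k α).1 y) := by
      rw [localRep_extD _ he hy, funext (localRep_wedgeTwo (e := e) ω α), localRep_extD α he hy,
        extDeriv_wedgeTwoL (ω.2.differentiableAt_localRep he hy)
          (α.2.differentiableAt_localRep he hy) extDeriv_localRep]
    _ = localRep e (wedgeTwo ω (k + 1) (extD k α) - wedgeOne θ (k + 2) (wedgeTwo ω k α)).1 y :=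
      congrArg₂ Sub.sub (localRep_wedgeTwo ω (extD k α) y).symm
        (localRep_wedgeOne θ (wedgeTwo ω k α) y).symm

theorem lich_lich {θ : Form m M 1} (hθ : extD 1 θ = 0) (l : ℤ) (α : Forms m M) :
    lich θ l (lich θ l α) = 0 := by
  refine Forms.ext fun k => ?_
  match k with
  | 0 => rfl
  | 1 => simp [comp_lich_succ, comp_lich_zero]
  | k + 2 =>
    simp only [comp_lich_succ, map_add, map_smul, extD_extD, extD_wedgeOne hθ,
      wedgeOne_wedgeOne_self, map_zero]
    module

theorem lich_lef {ω : Form m M 2} {θ : Form m M 1} (hω : extD 2 ω = -wedgeOne θ 2 ω) (l : ℤ)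
    (α : Forms m M) : lich θ l (lef ω α) = lef ω (lich θ (l - 1) α) := by
  refine Forms.ext fun k => ?_
  match k with
  | 0 => rfl
  | 1 => simp [comp_lich_succ, comp_lef_zero, comp_lef_one]
  | 2 => simp [comp_lich_succ, comp_lef_one, comp_lef_add_two, comp_lich_zero]
  | k + 3 =>
    simp only [comp_lich_succ, comp_lef_add_two, map_add, map_smul, extD_wedgeTwo hω,
      ← wedgeOne_wedgeTwo]
    push_cast
    module

theorem lich_lef_pow {ω : Form m M 2} {θ : Form m M 1} (hω : extD 2 ω = -wedgeOne θ 2 ω) (l : ℤ)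
    (r : ℕ) (α : Forms m M) :
    lich θ (l + r) ((lef ω ^ r) α) = (lef ω ^ r) (lich θ l α) := by
  induction r with
  | zero => simp
  | succ r ih =>
    rw [pow_succ', Module.End.mul_apply, Module.End.mul_apply, lich_lef hω, ← ih]
    push_cast
    congr 3
    ring

end Manifold

section WedgePow

variable {V : Type*} [NormedAddCommGroup V] [NormedSpace ℝ V]

/-- The `r`-th power of exterior multiplication by a `2`-form, on `k`-forms. -/
def wedgePow (V : Type*) [NormedAddCommGroup V] [NormedSpace ℝ V] (k : ℕ)
    (ω : V [⋀^Fin 2]→L[ℝ] ℝ) :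
    (r : ℕ) → (V [⋀^Fin k]→L[ℝ] ℝ) →L[ℝ] (V [⋀^Fin (k + 2 * r)]→L[ℝ] ℝ)
  | 0 => ContinuousLinearMap.id ℝ _
  | r + 1 => (wedgeTwoL V (k + 2 * r) ω).comp (wedgePow V k ω r)

theorem contDiff_wedgePow (k r : ℕ) :
    ContDiff ℝ (⊤ : ℕ∞) fun ω : V [⋀^Fin 2]→L[ℝ] ℝ => wedgePow V k ω r := by
  induction r with
  | zero => exact contDiff_const
  | succ r ih => exact (wedgeTwoL V (k + 2 * r)).contDiff.clm_comp ih

theorem wedgePow_comp {W : Type*} [NormedAddCommGroup W] [NormedSpace ℝ W] (k r : ℕ)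
    (ω : V [⋀^Fin 2]→L[ℝ] ℝ) (α : V [⋀^Fin k]→L[ℝ] ℝ) (f : W →L[ℝ] V) :
    (wedgePow V k ω r α).compContinuousLinearMap f =
      wedgePow W k (ω.compContinuousLinearMap f) r (α.compContinuousLinearMap f) := by
  induction r with
  | zero => rfl
  | succ r ih =>
    rw [wedgePow, wedgePow, ContinuousLinearMap.comp_apply, ContinuousLinearMap.comp_apply, ← ih]
    exact wedgeTwoL_comp ω _ f

theorem GradedForms.lef_pow_apply (ω : V [⋀^Fin 2]→L[ℝ] ℝ) (α : GradedForms V) (k r : ℕ) :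
    (GradedForms.lef ω ^ r) α (k + 2 * r) = wedgePow V k ω r (α k) := by
  induction r with
  | zero => rfl
  | succ r ih =>
    rw [pow_succ', wedgePow, ContinuousLinearMap.comp_apply, ← ih]
    rfl

variable [FiniteDimensional ℝ V] {ω : V [⋀^Fin 2]→L[ℝ] ℝ} {k r : ℕ}

theorem wedgePow_injective (hω : IsNondegenerate ω) (hkr : 2 * (k + r) ≤ Module.finrank ℝ V) :
    Function.Injective (wedgePow V k ω r) := by
  refine (injective_iff_map_eq_zero _).2 fun a ha => ?_
  have hα : GradedForms.IsHomogeneous (Pi.single k a : GradedForms V) k :=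
    fun j hj => by simp [hj]
  have lef_pow_eq_zero : (GradedForms.lef ω ^ r) (Pi.single k a) = 0 :=
    (hα.lef_pow ω r).eq_zero (by rw [GradedForms.lef_pow_apply, Pi.single_eq_same, ha])
  have single_eq_zero := GradedForms.eq_zero_of_lef_pow_eq_zero hω hkr hα lef_pow_eq_zero
  exact Pi.single_eq_zero_iff.1 single_eq_zero

theorem wedgePow_bijective (hω : IsNondegenerate ω) (hkr : 2 * (k + r) = Module.finrank ℝ V) :
    Function.Bijective (wedgePow V k ω r) := by
  have injective := wedgePow_injective hω hkr.le
  refine ⟨injective, (LinearMap.injective_iff_surjective_of_finrank_eq_finrank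
    (f := (wedgePow V k ω r).toLinearMap) ?_).1 injective⟩
  rw [finrank_continuousAlternatingMap, finrank_continuousAlternatingMap, ← hkr]
  exact Nat.choose_symm_of_eq_add (by ring)

theorem wedgePow_isInvertible (hω : IsNondegenerate ω) (hkr : 2 * (k + r) = Module.finrank ℝ V) :
    (wedgePow V k ω r).IsInvertible :=
  ⟨(LinearEquiv.ofBijective _ (wedgePow_bijective hω hkr)).toContinuousLinearEquiv, rfl⟩

end WedgePow

section HardLefschetz

variable {m : ℕ} {M : Type*} [TopologicalSpace M] [ChartedSpace (Model m) M] {ω : Form m M 2}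

/-- Non-degeneracy of a `2`-form on a manifold, at every point. -/
def Form.IsNondegenerate (ω : Form m M 2) : Prop :=
  ∀ x, LCS.IsNondegenerate (V := Model m) (ω.1 x)

theorem Form.eq_zero_of_lt {k : ℕ} (hk : m < k) (α : Form m M k) : α = 0 := by
  have finrank_eq_zero : Module.finrank ℝ (Model m [⋀^Fin k]→L[ℝ] ℝ) = 0 := by
    rw [finrank_continuousAlternatingMap, finrank_euclideanSpace_fin, Nat.choose_eq_zero_of_lt hk]
  have : Subsingleton (Model m [⋀^Fin k]→L[ℝ] ℝ) := Module.finrank_zero_iff.1 finrank_eq_zero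
  exact Subtype.ext <| funext fun x => Subsingleton.elim (α := Model m [⋀^Fin k]→L[ℝ] ℝ) _ _

theorem homog_eq_bot_of_lt {k : ℤ} (hk : m < k) : homog m M k = ⊥ :=
  (Submodule.eq_bot_iff _).2 fun α hα => Forms.ext fun j => by
    by_cases hj : (j : ℤ) = k
    · exact Form.eq_zero_of_lt (by omega) _
    · exact hα j hj

theorem lef_mem_homog (ω : Form m M 2) {i j : ℤ} (h : i + 2 = j) {α : Forms m M}
    (hα : α ∈ homog m M i) : lef ω α ∈ homog m M j
  | 0, _ => rfl
  | 1, _ => rfl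
  | k + 2, hk => by rw [comp_lef_add_two, hα k (by push_cast at hk; omega), map_zero]

theorem lef_pow_mem_homog (ω : Form m M 2) {i j : ℤ} {r : ℕ} (h : i + 2 * r = j) {α : Forms m M}
    (hα : α ∈ homog m M i) : (lef ω ^ r) α ∈ homog m M j := by
  subst h
  induction r with
  | zero => simpa using hα
  | succ r ih =>
    rw [pow_succ', Module.End.mul_apply]
    exact lef_mem_homog ω (by push_cast; ring) ih

theorem comp_lef_pow_apply (ω : Form m M 2) (α : Forms m M) (k r : ℕ) (x : M) :
    (Forms.comp (k + 2 * r) ((lef ω ^ r) α)).1 x =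
      wedgePow (Model m) k (ω.1 x) r ((Forms.comp k α).1 x) := by
  induction r with
  | zero => rfl
  | succ r ih =>
    rw [pow_succ']
    exact congrArg (wedgeTwoL (Model m) (k + 2 * r) (ω.1 x)) ih

theorem eq_zero_of_lef_pow_eq_zero (hω : Form.IsNondegenerate ω) {k : ℤ} {r : ℕ}
    (hkr : 2 * (k + r) ≤ m) {α : Forms m M} (hα : α ∈ homog m M k) (h : (lef ω ^ r) α = 0) :
    α = 0 := by
  refine Forms.ext fun j => ?_
  by_cases hj : (j : ℤ) = k
  · refine Subtype.ext <| funext fun x => wedgePow_injective (V := Model m) (r := r) (hω x)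
      (by rw [finrank_euclideanSpace_fin]; omega) ?_
    rw [← comp_lef_pow_apply, h]
    exact (map_zero _).symm
  · exact hα j hj

theorem exists_mem_homog_comp_eq {k : ℕ} (a : Form m M k) :
    ∃ α ∈ homog m M k, Forms.comp k α = a :=
  ⟨Forms.mk (Pi.single (M := fun j => Form m M j) k a),
    fun j hj => Pi.single_eq_of_ne (M := fun j => Form m M j) (by exact_mod_cast hj) a,
    Pi.single_eq_same (M := fun j => Form m M j) k a⟩

theorem localRep_wedgePow (ω : Form m M 2) {k r : ℕ} {γ : RoughForm m M k}
    {β : RoughForm m M (k + 2 * r)} (h : ∀ x, wedgePow (Model m) k (ω.1 x) r (γ x) = β x)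
    (e : OpenPartialHomeomorph M (Model m)) (y : Model m) :
    wedgePow (Model m) k (localRep e ω.1 y) r (localRep e γ y) = localRep e β y := by
  let D : Model m →L[ℝ] Model m := mfderiv (𝓡 m) (𝓡 m) e.symm y
  exact (wedgePow_comp (V := Model m) (W := Model m) k r (ω.1 (e.symm y)) (γ (e.symm y))
    D).symm.trans (congrArg
      (fun f : Model m [⋀^Fin (k + 2 * r)]→L[ℝ] ℝ => f.compContinuousLinearMap D) (h (e.symm y)))

variable [IsManifold (𝓡 m) (⊤ : ℕ∞) M]

theorem lich_mem_homog (θ : Form m M 1) (l : ℤ) {i j : ℤ} (h : i + 1 = j) {α : Forms m M}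
    (hα : α ∈ homog m M i) : lich θ l α ∈ homog m M j
  | 0, _ => rfl
  | k + 1, hk => by
    rw [comp_lich_succ, hα k (by push_cast at hk; omega), map_zero, map_zero, smul_zero, add_zero]

theorem Form.IsNondegenerate.localRep (hω : Form.IsNondegenerate ω)
    {e : OpenPartialHomeomorph M (Model m)} (he : e ∈ atlas (Model m) M) {y : Model m}
    (hy : y ∈ e.target) : LCS.IsNondegenerate (LCS.localRep e ω.1 y) := fun v hv => by
  obtain ⟨injective, surjective⟩ := mfderiv_symm_bijective he hy
  refine injective ((hω (e.symm y) _ fun w => ?_).trans (map_zero _).symm)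
  obtain ⟨w, rfl⟩ := surjective w
  refine Eq.trans (congrArg (ω.1 (e.symm y)) ?_) (hv w)
  ext i : 1
  fin_cases i <;> rfl

theorem isSmooth_of_wedgePow_eq (hω : Form.IsNondegenerate ω) {k r : ℕ} (hkr : 2 * (k + r) = m)
    {γ : RoughForm m M k} (β : Form m M (k + 2 * r))
    (h : ∀ x, wedgePow (Model m) k (ω.1 x) r (γ x) = β.1 x) : IsSmooth γ := fun e he => by
  have invertible {y : Model m} (hy : y ∈ e.target) :
      (wedgePow (Model m) k (localRep e ω.1 y) r).IsInvertible :=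
    wedgePow_isInvertible (hω.localRep he hy) (by rw [finrank_euclideanSpace_fin, hkr])
  have localRep_eq : ∀ y ∈ e.target, localRep e γ y =
      (wedgePow (Model m) k (localRep e ω.1 y) r).inverse (localRep e β.1 y) := fun y hy =>
    ((invertible hy).inverse_apply_eq.2 (localRep_wedgePow ω h e y).symm).symm
  refine ContDiffOn.congr (fun y hy => ?_) localRep_eq
  have contDiffAt : ContDiffAt ℝ (⊤ : ℕ∞) (fun y => wedgePow (Model m) k (localRep e ω.1 y) r) y :=
    (contDiff_wedgePow (V := Model m) k r).contDiffAt.comp y (ω.2.contDiffAt_localRep he hy)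
  exact (((invertible hy).contDiffAt_map_inverse.comp y contDiffAt).clm_apply
    (β.2.contDiffAt_localRep he hy)).contDiffWithinAt

theorem exists_wedgePow_eq (hω : Form.IsNondegenerate ω) {k r : ℕ} (hkr : 2 * (k + r) = m)
    (β : Form m M (k + 2 * r)) :
    ∃ γ : Form m M k, ∀ x, wedgePow (Model m) k (ω.1 x) r (γ.1 x) = β.1 x := by
  choose γ hγ using fun x => (wedgePow_bijective (V := Model m) (hω x)
    (by rw [finrank_euclideanSpace_fin, hkr])).2 (β.1 x)
  exact ⟨⟨γ, isSmooth_of_wedgePow_eq hω hkr β hγ⟩, hγ⟩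

theorem exists_lef_pow_eq (hω : Form.IsNondegenerate ω) {i j : ℤ} {r : ℕ} (hi : 2 * (i + r) = m)
    (hij : i + 2 * r = j) {β : Forms m M} (hβ : β ∈ homog m M j) :
    ∃ γ ∈ homog m M i, (lef ω ^ r) γ = β := by
  subst hij
  rcases lt_or_ge i 0 with hneg | hnonneg
  · rw [homog_eq_bot_of_lt (by omega)] at hβ
    exact ⟨0, zero_mem _, (map_zero _).trans ((Submodule.mem_bot ℝ).1 hβ).symm⟩
  lift i to ℕ using hnonneg
  obtain ⟨c, hc⟩ := exists_wedgePow_eq hω (by omega) (Forms.comp (i + 2 * r) β)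
  obtain ⟨γ, hγ, rfl⟩ := exists_mem_homog_comp_eq c
  refine ⟨γ, hγ, Forms.ext fun k => ?_⟩
  by_cases hk : k = i + 2 * r
  · subst hk
    exact Subtype.ext <| funext fun x => (comp_lef_pow_apply ω γ i r x).trans (hc x)
  · rw [lef_pow_mem_homog ω rfl hγ k (by omega), hβ k (by omega)]

end HardLefschetz

section Parts

variable {m : ℕ} {M : Type*} [TopologicalSpace M] [ChartedSpace (Model m) M]

/-- The projection of `Ω*(M)` onto `Ωᵏ(M)`, for `k ∈ ℤ`. -/
def part (k : ℤ) : Forms m M →ₗ[ℝ] Forms m M where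
  toFun α := Forms.mk fun j => if (j : ℤ) = k then Forms.comp j α else 0
  map_add' α β := Forms.ext fun j => by
    rw [map_add, Forms.comp_mk, Forms.comp_mk, Forms.comp_mk]
    split_ifs
    · exact map_add _ _ _
    · exact (add_zero _).symm
  map_smul' c α := Forms.ext fun j => by
    rw [map_smul, Forms.comp_mk, Forms.comp_mk]
    split_ifs
    · exact map_smul _ _ _
    · exact (smul_zero _).symm

theorem comp_part (k : ℤ) (j : ℕ) (α : Forms m M) :
    Forms.comp j (part k α) = if (j : ℤ) = k then Forms.comp j α else 0 := rfl

theorem part_mem_homog (k : ℤ) (α : Forms m M) : part k α ∈ homog m M k := fun j hj => by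
  rw [comp_part, if_neg hj]

theorem part_of_mem {k : ℤ} {α : Forms m M} (hα : α ∈ homog m M k) : part k α = α :=
  Forms.ext fun j => by
    rw [comp_part]
    split_ifs with h
    · rfl
    · exact (hα j h).symm

theorem part_of_mem_ne {i k : ℤ} (hik : i ≠ k) {α : Forms m M} (hα : α ∈ homog m M i) :
    part k α = 0 :=
  Forms.ext fun j => by
    rw [comp_part]
    split_ifs with h
    · exact hα j (by omega)
    · rfl

theorem eq_zero_of_part {α : Forms m M} (h : ∀ k : ℕ, part (k : ℤ) α = 0) : α = 0 :=
  Forms.ext fun j => by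
    have comp_part_eq_zero := congrArg (Forms.comp j) (h j)
    rwa [comp_part, if_pos rfl] at comp_part_eq_zero

theorem part_lef (ω : Form m M 2) {i j : ℤ} (h : i + 2 = j) (α : Forms m M) :
    part j (lef ω α) = lef ω (part i α) := by
  refine Forms.ext fun k => ?_
  by_cases hk : (k : ℤ) = j
  · rw [comp_part, if_pos hk]
    match k with
    | 0 => rw [comp_lef_zero, comp_lef_zero]
    | 1 => rw [comp_lef_one, comp_lef_one]
    | k + 2 =>
      rw [comp_lef_add_two, comp_lef_add_two, comp_part, if_pos (by push_cast at hk; omega)]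
  · rw [comp_part, if_neg hk, lef_mem_homog ω h (part_mem_homog i α) k hk]

theorem part_lef_pow (ω : Form m M 2) {i j : ℤ} {r : ℕ} (h : i + 2 * r = j) (α : Forms m M) :
    part j ((lef ω ^ r) α) = (lef ω ^ r) (part i α) := by
  subst h
  induction r with
  | zero => simp
  | succ r ih =>
    rw [pow_succ', Module.End.mul_apply, Module.End.mul_apply, ← ih]
    exact part_lef ω (by push_cast; ring) _

theorem exists_homog_of_mem_range {ω : Form m M 2} {i j : ℤ} {r : ℕ} (h : i + 2 * r = j)
    {α : Forms m M} (hα : α ∈ homog m M j) (hr : α ∈ LinearMap.range (lef ω ^ r)) :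
    ∃ β ∈ homog m M i, (lef ω ^ r) β = α := by
  obtain ⟨β, rfl⟩ := hr
  exact ⟨part i β, part_mem_homog i β, by rw [← part_lef_pow ω h, part_of_mem hα]⟩

theorem sum_part (α : Forms m M) : ∑ k ∈ Finset.range (m + 1), part (k : ℤ) α = α := by
  refine Forms.ext fun j => ?_
  by_cases hj : j ≤ m
  · rw [map_sum, Finset.sum_eq_single_of_mem j (Finset.mem_range.2 (by omega))]
    · rw [comp_part, if_pos rfl]
    · intro k _ hk
      rw [comp_part, if_neg (by exact_mod_cast hk.symm)]
  · rw [Form.eq_zero_of_lt (by omega) (Forms.comp j α)]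
    exact Form.eq_zero_of_lt (by omega) _

end Parts

section LefschetzDecomposition

variable {n : ℕ} {M : Type*} [TopologicalSpace M] [ChartedSpace (Model (2 * n)) M]
  {ω : Form (2 * n) M 2} {i k : ℤ} {r : ℕ} {x γ α : Forms (2 * n) M}

theorem prim_le_homog (ω : Form (2 * n) M 2) (k : ℤ) : prim ω k ≤ homog (2 * n) M k := by
  rw [prim]
  split_ifs
  · exact inf_le_left
  · exact bot_le

theorem prim_eq_bot (hk : n < k) : prim ω k = ⊥ := if_neg (by omega)

theorem mem_prim (hkr : k + r = n + 1) (hx : x ∈ homog (2 * n) M k) :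
    x ∈ prim ω k ↔ (lef ω ^ r) x = 0 := by
  rw [prim]
  split_ifs with hk
  · rw [show (((n : ℤ) - k + 1).toNat) = r by omega]
    exact ⟨fun h => h.2, fun h => ⟨hx, h⟩⟩
  · obtain rfl : r = 0 := by omega
    exact Iff.rfl

theorem lef_pow_eq_zero_of_mem_prim (hkr : k + r = n + 1) (hx : x ∈ prim ω k) :
    (lef ω ^ r) x = 0 :=
  (mem_prim hkr (prim_le_homog ω k hx)).1 hx

theorem eq_zero_of_lef_eq_zero (hω : Form.IsNondegenerate ω) (hk : k + 1 ≤ n)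
    (hα : α ∈ homog (2 * n) M k) (h : lef ω α = 0) : α = 0 :=
  eq_zero_of_lef_pow_eq_zero hω (r := 1) (by push_cast; omega) hα (by rwa [pow_one])

theorem part_mem_prim (hx : x ∈ primTotal ω) (k : ℤ) : part k x ∈ prim ω k := by
  suffices primTotal ω ≤ (prim ω k).comap (part k) from this hx
  refine iSup_le fun i y hy => ?_
  rw [Submodule.mem_comap]
  by_cases hik : i = k
  · subst hik
    rwa [part_of_mem (prim_le_homog ω i hy)]
  · rw [part_of_mem_ne hik (prim_le_homog ω i hy)]
    exact zero_mem _

theorem lef_eq_zero_of_mem_prim (hω : Form.IsNondegenerate ω) (hik : i + 2 = k)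
    (hγ : γ ∈ homog (2 * n) M i) (hprim : lef ω γ ∈ prim ω k) : lef ω γ = 0 := by
  rcases le_or_gt k n with hk | hk
  · obtain ⟨r, hr⟩ : ∃ r : ℕ, k + r = n + 1 := ⟨(n + 1 - k).toNat, by omega⟩
    have lef_pow_succ_eq_zero : (lef ω ^ (r + 1)) γ = 0 := by
      rw [pow_succ, Module.End.mul_apply]
      exact lef_pow_eq_zero_of_mem_prim hr hprim
    rw [eq_zero_of_lef_pow_eq_zero hω (by push_cast; omega) hγ lef_pow_succ_eq_zero, map_zero]
  · rwa [prim_eq_bot hk] at hprim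

theorem eq_zero_of_mem_lowForms (hω : Form.IsNondegenerate ω) (hα : α ∈ lowForms n M)
    (h : lef ω α = 0) : α = 0 := by
  refine eq_zero_of_part fun k => ?_
  rcases lt_or_ge k n with hk | hk
  · refine eq_zero_of_lef_eq_zero hω (by omega) (part_mem_homog (k : ℤ) α) ?_
    rw [← part_lef ω rfl, h, map_zero]
  · refine Forms.ext fun j => ?_
    rw [comp_part]
    split_ifs with hj
    · exact hα j (by omega)
    · rfl

theorem lefInv_lef (hω : Form.IsNondegenerate ω) (hα : α ∈ lowForms n M) :
    lefInv ω (lef ω α) = α := by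
  obtain ⟨T, hT⟩ := (lef ω ∘ₗ (lowForms n M).subtype).exists_leftInverse_of_injective <|
    LinearMap.ker_eq_bot'.2 fun β hβ => Subtype.ext (eq_zero_of_mem_lowForms hω β.2 hβ)
  have exists_inverse : ∃ T : Forms (2 * n) M →ₗ[ℝ] Forms (2 * n) M,
      ∀ α ∈ lowForms n M, T (lef ω α) = α :=
    ⟨(lowForms n M).subtype ∘ₗ T, fun α hα =>
      congrArg Subtype.val (LinearMap.congr_fun hT ⟨α, hα⟩)⟩
  rw [lefInv, dif_pos exists_inverse]
  exact exists_inverse.choose_spec α hα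

theorem mem_lowForms (hk : k + 1 ≤ n) (hα : α ∈ homog (2 * n) M k) : α ∈ lowForms n M :=
  fun j hj => hα j (by omega)

variable [IsManifold (𝓡 (2 * n)) (⊤ : ℕ∞) M]

/-- For `k ≤ n` one solves `Lⁿ⁻ᵏ⁺² γ = Lⁿ⁻ᵏ⁺¹ α`; for `k > n` already `Lᵏ⁻ⁿ` is onto `Ωᵏ`. -/
theorem exists_prim_add_lef (hω : Form.IsNondegenerate ω) (hik : i + 2 = k)
    (hα : α ∈ homog (2 * n) M k) :
    ∃ x ∈ prim ω k, ∃ γ ∈ homog (2 * n) M i, α = x + lef ω γ := by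
  rcases le_or_gt k n with hk | hk
  · obtain ⟨r, hr⟩ : ∃ r : ℕ, k + r = n + 1 := ⟨(n + 1 - k).toNat, by omega⟩
    obtain ⟨γ, hγ, h⟩ := exists_lef_pow_eq hω (i := i) (r := r + 1) (by push_cast; omega)
      (by push_cast; omega) (lef_pow_mem_homog ω (r := r) rfl hα)
    have lef_mem : lef ω γ ∈ homog (2 * n) M k := lef_mem_homog ω hik hγ
    refine ⟨α - lef ω γ, ?_, γ, hγ, (sub_add_cancel _ _).symm⟩
    rw [mem_prim hr (sub_mem hα lef_mem), map_sub, ← h, pow_succ, Module.End.mul_apply, sub_self]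
  · obtain ⟨r, hr⟩ : ∃ r : ℕ, n + (r + 1 : ℤ) = k := ⟨(k - n - 1).toNat, by omega⟩
    obtain ⟨γ, hγ, rfl⟩ := exists_lef_pow_eq hω (i := n - (r + 1)) (r := r + 1)
      (by push_cast; omega) (by push_cast; omega) hα
    refine ⟨0, zero_mem _, (lef ω ^ r) γ, lef_pow_mem_homog ω (by omega) hγ, ?_⟩
    rw [zero_add, pow_succ', Module.End.mul_apply]

theorem isCompl_primTotal (hω : Form.IsNondegenerate ω) :
    IsCompl (primTotal ω) (LinearMap.range (lef ω)) := by
  refine ⟨Submodule.disjoint_def.2 fun x hx hr => ?_, ?_⟩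
  · obtain ⟨γ, rfl⟩ := hr
    refine eq_zero_of_part fun k => ?_
    have part_mem := part_mem_prim hx k
    rw [part_lef ω (sub_add_cancel (k : ℤ) 2)] at part_mem ⊢
    exact lef_eq_zero_of_mem_prim hω (sub_add_cancel _ _) (part_mem_homog _ γ) part_mem
  · rw [codisjoint_iff, Submodule.eq_top_iff']
    intro α
    rw [← sum_part α]
    refine sum_mem fun k _ => ?_
    obtain ⟨x, hx, γ, -, h⟩ :=
      exists_prim_add_lef hω (sub_add_cancel (k : ℤ) 2) (part_mem_homog (k : ℤ) α)
    rw [h]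
    exact Submodule.add_mem_sup (Submodule.mem_iSup_of_mem (k : ℤ) hx) ⟨γ, rfl⟩

theorem primProj_of_mem_prim (hω : Form.IsNondegenerate ω) (hx : x ∈ prim ω k) :
    primProj ω x = x := by
  rw [primProj, dif_pos (isCompl_primTotal hω)]
  exact Submodule.projection_apply_of_mem_left _ (Submodule.mem_iSup_of_mem k hx)

theorem primProj_lef (hω : Form.IsNondegenerate ω) (γ : Forms (2 * n) M) :
    primProj ω (lef ω γ) = 0 := by
  rw [primProj, dif_pos (isCompl_primTotal hω), Submodule.projection_apply_eq_zero_iff]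
  exact ⟨γ, rfl⟩

theorem primProj_add_lef (hω : Form.IsNondegenerate ω) (hx : x ∈ prim ω k)
    (γ : Forms (2 * n) M) : primProj ω (x + lef ω γ) = x := by
  rw [map_add, primProj_of_mem_prim hω hx, primProj_lef hω, add_zero]

theorem primProj_mem_prim (hω : Form.IsNondegenerate ω) (hα : α ∈ homog (2 * n) M k) :
    primProj ω α ∈ prim ω k := by
  obtain ⟨x, hx, γ, -, rfl⟩ := exists_prim_add_lef hω (sub_add_cancel k 2) hα
  rwa [primProj_add_lef hω hx]

theorem exists_primProj_add_lef_eq (hω : Form.IsNondegenerate ω) (hik : i + 2 = k)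
    (hα : α ∈ homog (2 * n) M k) :
    ∃ γ ∈ homog (2 * n) M i, primProj ω α + lef ω γ = α := by
  obtain ⟨x, hx, γ, hγ, rfl⟩ := exists_prim_add_lef hω hik hα
  exact ⟨γ, hγ, by rw [primProj_add_lef hω hx]⟩

end LefschetzDecomposition

section SplitDifferential

variable {n : ℕ} {M : Type*} [TopologicalSpace M] [ChartedSpace (Model (2 * n)) M]
  [IsManifold (𝓡 (2 * n)) (⊤ : ℕ∞) M] {ω : Form (2 * n) M 2} {θ : Form (2 * n) M 1}
  {l i j k : ℤ} {r : ℕ} {x γ α : Forms (2 * n) M}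

theorem dPlus_eq_of_lich_eq (hω : Form.IsNondegenerate ω) (hx : x ∈ prim ω j)
    (h : lich θ l α = x + lef ω γ) : dPlus ω θ l α = x := by
  rw [dPlus, LinearMap.comp_apply, h, primProj_add_lef hω hx]

theorem dMinus_eq_of_lich_eq (hω : Form.IsNondegenerate ω) (hx : x ∈ prim ω j)
    (hγ : γ ∈ homog (2 * n) M i) (hi : i + 1 ≤ n) (h : lich θ l α = x + lef ω γ) :
    dMinus ω θ l α = γ := by
  rw [dMinus, LinearMap.comp_apply, LinearMap.sub_apply, dPlus_eq_of_lich_eq hω hx h, h,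
    add_sub_cancel_left, lefInv_lef hω (mem_lowForms hi hγ)]

theorem dPlus_mem_prim (hω : Form.IsNondegenerate ω) (θ : Form (2 * n) M 1) (l : ℤ)
    (hkj : k + 1 = j) (hα : α ∈ homog (2 * n) M k) : dPlus ω θ l α ∈ prim ω j :=
  primProj_mem_prim hω (lich_mem_homog θ l hkj hα)

theorem exists_lich_eq_dPlus_add_lef (hω : Form.IsNondegenerate ω) (θ : Form (2 * n) M 1) (l : ℤ)
    (hik : i + 1 = k) (hα : α ∈ homog (2 * n) M k) :
    ∃ γ ∈ homog (2 * n) M i, lich θ l α = dPlus ω θ l α + lef ω γ := by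
  obtain ⟨γ, hγ, h⟩ :=
    exists_primProj_add_lef_eq hω (show i + 2 = k + 1 by omega) (lich_mem_homog θ l rfl hα)
  exact ⟨γ, hγ, h.symm⟩

theorem dMinus_mem_homog (hω : Form.IsNondegenerate ω) (θ : Form (2 * n) M 1) (l : ℤ)
    (hik : i + 1 = k) (hk : k ≤ n) (hα : α ∈ homog (2 * n) M k) :
    dMinus ω θ l α ∈ homog (2 * n) M i := by
  obtain ⟨γ, hγ, h⟩ := exists_lich_eq_dPlus_add_lef hω θ l hik hα
  rwa [dMinus_eq_of_lich_eq hω (dPlus_mem_prim hω θ l rfl hα) hγ (by omega) h]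

theorem lich_eq_dPlus_add_lef_dMinus (hω : Form.IsNondegenerate ω) (θ : Form (2 * n) M 1) (l : ℤ)
    (hk : k ≤ n) (hα : α ∈ homog (2 * n) M k) :
    lich θ l α = dPlus ω θ l α + lef ω (dMinus ω θ l α) := by
  obtain ⟨γ, hγ, h⟩ := exists_lich_eq_dPlus_add_lef hω θ l (sub_add_cancel k 1) hα
  rwa [dMinus_eq_of_lich_eq hω (dPlus_mem_prim hω θ l rfl hα) hγ (by omega) h]

theorem dMinus_eq_zero_of_lich_eq_zero (h : lich θ l α = 0) : dMinus ω θ l α = 0 := by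
  rw [dMinus, LinearMap.comp_apply, LinearMap.sub_apply, dPlus, LinearMap.comp_apply, h, map_zero,
    sub_zero, map_zero]

theorem lef_pow_lich_eq (hω : Form.IsNondegenerate ω) (θ : Form (2 * n) M 1) (l : ℤ)
    (hkr : k + r = n) (hα : α ∈ homog (2 * n) M k) :
    (lef ω ^ r) (lich θ l α) = (lef ω ^ (r + 1)) (dMinus ω θ l α) := by
  rw [lich_eq_dPlus_add_lef_dMinus hω θ l (by omega) hα, map_add,
    lef_pow_eq_zero_of_mem_prim (by omega) (dPlus_mem_prim hω θ l rfl hα), zero_add, pow_succ,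
    Module.End.mul_apply]

theorem dMinus_eq_zero_iff (hω : Form.IsNondegenerate ω) (θ : Form (2 * n) M 1) (l : ℤ)
    (hkr : k + r = n) (hα : α ∈ homog (2 * n) M k) :
    dMinus ω θ l α = 0 ↔ (lef ω ^ r) (lich θ l α) = 0 := by
  rw [lef_pow_lich_eq hω θ l hkr hα]
  refine ⟨fun h => by rw [h, map_zero], fun h => ?_⟩
  exact eq_zero_of_lef_pow_eq_zero hω (by push_cast; omega)
    (dMinus_mem_homog hω θ l (sub_add_cancel k 1) (by omega) hα) h

end SplitDifferential

section Subquotients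

variable {V : Type*} [AddCommGroup V] [Module ℝ V] {A B A' B' A'' B'' : Submodule ℝ V}

theorem SubQuot.cls_eq_cls_iff {x y : V} (hx : x ∈ A) (hy : y ∈ A) :
    (SubQuot.cls x hx : SubQuot A B) = SubQuot.cls y hy ↔ x - y ∈ B := by
  rw [SubQuot.cls, SubQuot.cls, Submodule.mkQ_apply, Submodule.mkQ_apply, Submodule.Quotient.eq]
  exact Iff.rfl

theorem SubQuot.cls_eq_zero_iff {x : V} (hx : x ∈ A) :
    (SubQuot.cls x hx : SubQuot A B) = 0 ↔ x ∈ B := by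
  rw [SubQuot.cls, Submodule.mkQ_apply, Submodule.Quotient.mk_eq_zero]
  exact Iff.rfl

theorem SubQuot.exists_cls_eq (c : SubQuot A B) : ∃ (x : V) (hx : x ∈ A), SubQuot.cls x hx = c := by
  obtain ⟨⟨x, hx⟩, h⟩ := (B.submoduleOf A).mkQ_surjective c
  exact ⟨x, hx, h⟩

theorem exists_isGivenBy {S : Submodule ℝ V} {f g : V →ₗ[ℝ] V} (hf : ∀ x ∈ S, f x ∈ A)
    (hg : ∀ x ∈ S, g x ∈ A') (hrep : ∀ a ∈ A, ∃ x ∈ S, a - f x ∈ B)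
    (hker : ∀ x ∈ S, f x ∈ B → g x ∈ B') :
    ∃ φ : SubQuot A B →ₗ[ℝ] SubQuot A' B', IsGivenBy φ S f g := by
  let F : S →ₗ[ℝ] SubQuot A B := (B.submoduleOf A).mkQ ∘ₗ f.restrict hf
  let G : S →ₗ[ℝ] SubQuot A' B' := (B'.submoduleOf A').mkQ ∘ₗ g.restrict hg
  have F_surjective : Function.Surjective F := fun c => by
    obtain ⟨a, ha, rfl⟩ := c.exists_cls_eq
    obtain ⟨x, hx, h⟩ := hrep a ha
    exact ⟨⟨x, hx⟩, ((SubQuot.cls_eq_cls_iff ha (hf x hx)).2 h).symm⟩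
  have G_eq_zero : ∀ x, F x = 0 → G x = 0 := fun x hx =>
    (SubQuot.cls_eq_zero_iff (hg x x.2)).2
      (hker x x.2 ((SubQuot.cls_eq_zero_iff (hf x x.2)).1 hx))
  obtain ⟨s, hs⟩ := F.exists_rightInverse_of_surjective (LinearMap.range_eq_top.2 F_surjective)
  refine ⟨G ∘ₗ s, fun c => ?_, fun x hx => ⟨hf x hx, hg x hx, ?_⟩⟩
  · obtain ⟨x, rfl⟩ := F_surjective c
    exact ⟨x, x.2, hf x x.2, rfl⟩
  · change G (s (F ⟨x, hx⟩)) = G ⟨x, hx⟩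
    rw [← sub_eq_zero, ← map_sub]
    refine G_eq_zero _ ?_
    rw [map_sub, ← LinearMap.comp_apply, hs, LinearMap.id_apply, sub_self]

theorem exists_isInducedBy {g : V →ₗ[ℝ] V} (hg : ∀ x ∈ A, g x ∈ A')
    (hker : ∀ x ∈ A, x ∈ B → g x ∈ B') :
    ∃ φ : SubQuot A B →ₗ[ℝ] SubQuot A' B', IsInducedBy φ g :=
  exists_isGivenBy (fun _ hx => hx) hg (fun a ha => ⟨a, ha, by simp⟩) hker

theorem IsGivenBy.exact {φ : SubQuot A B →ₗ[ℝ] SubQuot A' B'}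
    {ψ : SubQuot A' B' →ₗ[ℝ] SubQuot A'' B''} {S S' : Submodule ℝ V} {f g f' g' : V →ₗ[ℝ] V}
    (hφ : IsGivenBy φ S f g) (hψ : IsGivenBy ψ S' f' g')
    (h : ∀ y ∈ S', g' y ∈ B'' ↔ ∃ x ∈ S, f' y - g x ∈ B') : Function.Exact φ ψ := by
  intro c
  obtain ⟨y, hy, hfy, rfl⟩ := hψ.exists_rep c
  obtain ⟨_, hgy, map_y⟩ := hψ.map_rep y hy
  rw [map_y, SubQuot.cls_eq_zero_iff, h y hy]
  constructor
  · rintro ⟨x, hx, hxy⟩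
    obtain ⟨hfx, hgx, map_x⟩ := hφ.map_rep x hx
    exact ⟨_, map_x.trans ((SubQuot.cls_eq_cls_iff hfy hgx).2 hxy).symm⟩
  · rintro ⟨b, hb⟩
    obtain ⟨x, hx, hfx, rfl⟩ := hφ.exists_rep b
    obtain ⟨_, hgx, map_x⟩ := hφ.map_rep x hx
    exact ⟨x, hx, (SubQuot.cls_eq_cls_iff hfy hgx).1 (hb.symm.trans map_x)⟩

theorem IsGivenBy.surjective {φ : SubQuot A B →ₗ[ℝ] SubQuot A' B'} {S : Submodule ℝ V}
    {f g : V →ₗ[ℝ] V} (hφ : IsGivenBy φ S f g) (h : ∀ y ∈ A', ∃ x ∈ S, g x = y) :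
    Function.Surjective φ := by
  intro c
  obtain ⟨a, ha, rfl⟩ := c.exists_cls_eq
  obtain ⟨x, hx, rfl⟩ := h a ha
  obtain ⟨_, _, map_x⟩ := hφ.map_rep x hx
  exact ⟨_, map_x⟩

end Subquotients

section CyclesAndBoundaries

variable {m : ℕ} {M : Type*} [TopologicalSpace M] [ChartedSpace (Model m) M]
  {ω : Form m M 2} {θ : Form m M 1} {i j k q l p' : ℤ} {p : ℕ} {α γ : Forms m M}

theorem mem_filt_inf_homog (hp : p' = p) (h : i + 2 * p = j) :
    α ∈ filt ω p' ⊓ homog m M j ↔ ∃ β ∈ homog m M i, (lef ω ^ p) β = α := by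
  rw [filt, hp, Int.toNat_natCast]
  constructor
  · rintro ⟨hr, hα⟩
    exact exists_homog_of_mem_range h hα hr
  · rintro ⟨β, hβ, rfl⟩
    exact ⟨⟨β, rfl⟩, lef_pow_mem_homog ω h hβ⟩

variable [IsManifold (𝓡 m) (⊤ : ℕ∞) M]

/-- The space `ker d_l ∩ Ωᵏ` of cocycles, the numerator of `Hᵏ_l`. -/
abbrev cocycles (θ : Form m M 1) (l k : ℤ) : Submodule ℝ (Forms m M) :=
  LinearMap.ker (lich θ l) ⊓ homog m M k

/-- The space `d_l Ωᵏ⁻¹` of coboundaries, the denominator of `Hᵏ_l` and of `Cᵏ_l`. -/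
abbrev coboundaries (θ : Form m M 1) (l k : ℤ) : Submodule ℝ (Forms m M) :=
  (homog m M (k - 1)).map (lich θ l)

/-- The denominator `Z_{r-1}^{p+1,q-1} + d_k Z_{r-1}^{p-r+1,q+r-2}` of `E^{p,q}_{k,r}`. -/
abbrev pageBoundary (ω : Form m M 2) (θ : Form m M 1) (k r p q : ℤ) : Submodule ℝ (Forms m M) :=
  cyc ω θ k (r - 1) (p + 1) (q - 1) ⊔ (cyc ω θ k (r - 1) (p - r + 1) (q + r - 2)).map (lich θ k)

theorem mem_coboundaries (hik : i + 1 = k) :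
    α ∈ coboundaries θ l k ↔ ∃ η ∈ homog m M i, lich θ l η = α := by
  rw [coboundaries, show k - 1 = i by omega]
  exact Iff.rfl

theorem mem_cyc_one (h : k + p = q) :
    α ∈ cyc ω θ l 1 p q ↔
      (∃ β ∈ homog m M k, (lef ω ^ p) β = α) ∧ lich θ l α ∈ LinearMap.range (lef ω ^ (p + 1)) := by
  rw [cyc, Submodule.mem_inf, mem_filt_inf_homog (i := k) rfl (by omega), Submodule.mem_comap,
    filt, show ((p : ℤ) + 1).toNat = p + 1 by omega]

theorem mem_cyc_zero (hd : extD 2 ω = -wedgeOne θ 2 ω) (hp : p' = p) (h : k + p = q) :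
    α ∈ cyc ω θ l 0 p' q ↔ ∃ β ∈ homog m M k, (lef ω ^ p) β = α := by
  rw [cyc, Submodule.mem_inf, mem_filt_inf_homog (i := k) hp (by omega), and_iff_left_iff_imp]
  rintro ⟨β, -, rfl⟩
  rw [Submodule.mem_comap, filt, show (p' + 0).toNat = p by omega, ← sub_add_cancel l p,
    lich_lef_pow hd]
  exact ⟨_, rfl⟩

theorem mem_pageBoundary_one (hd : extD 2 ω = -wedgeOne θ 2 ω) (h : k + p = q) (hik : i + 2 = k) :
    α ∈ pageBoundary ω θ (l + p) 1 p q ↔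
      ∃ γ ∈ homog m M i, ∃ β ∈ coboundaries θ l k, (lef ω ^ p) (lef ω γ + β) = α := by
  have mem_left : ∀ a, a ∈ cyc ω θ (l + p) (1 - 1) (p + 1) (q - 1) ↔
      ∃ γ ∈ homog m M i, (lef ω ^ (p + 1)) γ = a := fun a =>
    mem_cyc_zero hd (by push_cast; ring) (by push_cast; omega)
  have mem_right : ∀ a, a ∈ cyc ω θ (l + p) (1 - 1) (p - 1 + 1) (q + 1 - 2) ↔
      ∃ η ∈ homog m M (k - 1), (lef ω ^ p) η = a := fun a =>
    mem_cyc_zero hd (by ring) (by omega)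
  simp only [pageBoundary, coboundaries, Submodule.mem_sup, Submodule.mem_map, mem_left, mem_right]
  constructor
  · rintro ⟨_, ⟨γ, hγ, rfl⟩, _, ⟨_, ⟨η, hη, rfl⟩, rfl⟩, rfl⟩
    exact ⟨γ, hγ, _, ⟨η, hη, rfl⟩, by rw [lich_lef_pow hd, map_add, pow_succ, Module.End.mul_apply]⟩
  · rintro ⟨γ, hγ, _, ⟨η, hη, rfl⟩, rfl⟩
    exact ⟨_, ⟨γ, hγ, rfl⟩, _, ⟨_, ⟨η, hη, rfl⟩, rfl⟩,
      by rw [lich_lef_pow hd, map_add, pow_succ, Module.End.mul_apply]⟩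

theorem lef_pow_mem_pageBoundary (hd : extD 2 ω = -wedgeOne θ 2 ω) (h : k + p = q)
    (hik : i + 2 = k) (hγ : γ ∈ homog m M i) (hα : α - lef ω γ ∈ coboundaries θ l k) :
    (lef ω ^ p) α ∈ pageBoundary ω θ (l + p) 1 p q :=
  (mem_pageBoundary_one hd h hik).2 ⟨γ, hγ, _, hα, by rw [add_sub_cancel]⟩

theorem coboundaries_le_homog (θ : Form m M 1) (l k : ℤ) : coboundaries θ l k ≤ homog m M k := by
  rintro _ ⟨η, hη, rfl⟩
  exact lich_mem_homog θ l (sub_add_cancel k 1) hη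

end CyclesAndBoundaries

/-- The space of `k`-forms annihilated by `d_l⁻`, the numerator of `Cᵏ_l`. -/
abbrev minusCocycles {n : ℕ} {M : Type*} [TopologicalSpace M] [ChartedSpace (Model (2 * n)) M]
    [IsManifold (𝓡 (2 * n)) (⊤ : ℕ∞) M] (ω : Form (2 * n) M 2) (θ : Form (2 * n) M 1) (l k : ℤ) :
    Submodule ℝ (Forms (2 * n) M) :=
  LinearMap.ker (dMinus ω θ l) ⊓ homog (2 * n) M k

namespace IsLCS

variable {n : ℕ} {M : Type*} [TopologicalSpace M] [ChartedSpace (Model (2 * n)) M]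
  [IsManifold (𝓡 (2 * n)) (⊤ : ℕ∞) M] {ω : Form (2 * n) M 2} {θ : Form (2 * n) M 1}
  {l l' i j k q : ℤ} {p r : ℕ} {x α β γ : Forms (2 * n) M}

theorem isNondegenerate (hω : IsLCS ω θ) : Form.IsNondegenerate ω := hω.nondegenerate

theorem lich_lich (hω : IsLCS ω θ) (l : ℤ) (α : Forms (2 * n) M) : lich θ l (lich θ l α) = 0 :=
  LCS.lich_lich hω.closed l α

theorem lich_lef (hω : IsLCS ω θ) (l : ℤ) (α : Forms (2 * n) M) :
    lich θ l (lef ω α) = lef ω (lich θ (l - 1) α) :=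
  LCS.lich_lef hω.d_form l α

theorem lich_lef_pow (hω : IsLCS ω θ) (hl : l + r = l') (α : Forms (2 * n) M) :
    lich θ l' ((lef ω ^ r) α) = (lef ω ^ r) (lich θ l α) := by
  rw [← hl, LCS.lich_lef_pow hω.d_form]

theorem dPlus_lef (hω : IsLCS ω θ) (l : ℤ) (γ : Forms (2 * n) M) :
    dPlus ω θ l (lef ω γ) = 0 := by
  rw [dPlus, LinearMap.comp_apply, hω.lich_lef, primProj_lef hω.isNondegenerate]

theorem dMinus_lef (hω : IsLCS ω θ) (l : ℤ) (hi : i + 2 ≤ n) (hγ : γ ∈ homog (2 * n) M i) :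
    dMinus ω θ l (lef ω γ) = lich θ (l - 1) γ :=
  dMinus_eq_of_lich_eq hω.isNondegenerate (zero_mem (prim ω 0)) (lich_mem_homog θ (l - 1) rfl hγ)
    (by omega) (by rw [hω.lich_lef, zero_add])

theorem cocycles_le_minusCocycles (ω : Form (2 * n) M 2) (θ : Form (2 * n) M 1) (l k : ℤ) :
    cocycles θ l k ≤ minusCocycles ω θ l k :=
  fun _ hα => ⟨dMinus_eq_zero_of_lich_eq_zero hα.1, hα.2⟩

theorem dMinus_eq_of_sub_lef_mem_coboundaries (hω : IsLCS ω θ) (hik : i + 2 = k) (hk : k ≤ n)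
    (hγ : γ ∈ homog (2 * n) M i) (h : α - lef ω γ ∈ coboundaries θ l k) :
    dMinus ω θ l α = lich θ (l - 1) γ := by
  obtain ⟨η, -, hη⟩ := h
  have dMinus_sub : dMinus ω θ l (α - lef ω γ) = 0 := by
    rw [← hη, dMinus_eq_zero_of_lich_eq_zero (hω.lich_lich l η)]
  rwa [map_sub, hω.dMinus_lef l (by omega) hγ, sub_eq_zero] at dMinus_sub

theorem dPlus_primProj (hω : IsLCS ω θ) (l : ℤ) (hα : α ∈ homog (2 * n) M k) :
    dPlus ω θ l (primProj ω α) = dPlus ω θ l α := by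
  obtain ⟨γ, -, hαγ⟩ := exists_primProj_add_lef_eq hω.isNondegenerate (sub_add_cancel k 2) hα
  rw [eq_sub_of_add_eq hαγ, map_sub, hω.dPlus_lef, sub_zero]

theorem dMinus_sub_dMinus_primProj_mem_coboundaries (hω : IsLCS ω θ) (l : ℤ) (hik : i + 1 = k)
    (hk : k ≤ n) (hα : α ∈ homog (2 * n) M k) :
    dMinus ω θ l α - dMinus ω θ l (primProj ω α) ∈ coboundaries θ (l - 1) i := by
  obtain ⟨γ, hγ, hαγ⟩ :=
    exists_primProj_add_lef_eq hω.isNondegenerate (show i - 1 + 2 = k by omega) hα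
  refine (mem_coboundaries (sub_add_cancel i 1)).2 ⟨γ, hγ, ?_⟩
  rw [← hω.dMinus_lef l (by omega) hγ, ← map_sub, eq_sub_of_add_eq' hαγ]

theorem lich_eq_lef_dMinus (hω : IsLCS ω θ) (hk : k ≤ n) (hα : α ∈ homog (2 * n) M k)
    (h : dPlus ω θ l α = 0) : lich θ l α = lef ω (dMinus ω θ l α) := by
  rw [lich_eq_dPlus_add_lef_dMinus hω.isNondegenerate θ l hk hα, h, zero_add]

/-! ### Well-definedness of the maps -/

theorem lef_mem_cocycles (hω : IsLCS ω θ) (hij : i + 2 = j) (hα : α ∈ cocycles θ (l - 1) i) :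
    lef ω α ∈ cocycles θ l j :=
  ⟨LinearMap.mem_ker.2 (by rw [hω.lich_lef, LinearMap.mem_ker.1 hα.1, map_zero]),
    lef_mem_homog ω hij hα.2⟩

theorem lef_pow_mem_coboundaries (hω : IsLCS ω θ) (hl : l + r = l') (hij : i + 2 * r = j)
    (hα : α ∈ coboundaries θ l i) : (lef ω ^ r) α ∈ coboundaries θ l' j := by
  obtain ⟨η, hη, rfl⟩ := hα
  exact ⟨(lef ω ^ r) η, lef_pow_mem_homog ω (by omega) hη, hω.lich_lef_pow hl η⟩

theorem lef_mem_coboundaries (hω : IsLCS ω θ) (hij : i + 2 = j)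
    (hα : α ∈ coboundaries θ (l - 1) i) : lef ω α ∈ coboundaries θ l j := by
  rw [← pow_one (lef ω)]
  exact hω.lef_pow_mem_coboundaries (by push_cast; ring) (by push_cast; omega) hα

theorem lef_pow_mem_cyc (hω : IsLCS ω θ) (h : k + p = q) (hα : α ∈ homog (2 * n) M k)
    (hd : (lef ω ^ p) (lich θ l α) ∈ LinearMap.range (lef ω ^ (p + 1))) :
    (lef ω ^ p) α ∈ cyc ω θ (l + p) 1 p q :=
  (mem_cyc_one h).2 ⟨⟨α, hα, rfl⟩, by rwa [hω.lich_lef_pow rfl]⟩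

theorem lef_pow_mem_cyc_of_mem_cocycles (hω : IsLCS ω θ) (h : k + p = q)
    (hα : α ∈ cocycles θ l k) : (lef ω ^ p) α ∈ cyc ω θ (l + p) 1 p q :=
  hω.lef_pow_mem_cyc h hα.2 (by rw [LinearMap.mem_ker.1 hα.1, map_zero]; exact zero_mem _)

theorem lef_pow_mem_cyc_of_dPlus_eq_zero (hω : IsLCS ω θ) (h : k + p = q) (hk : k ≤ n)
    (hα : α ∈ homog (2 * n) M k) (hd : dPlus ω θ l α = 0) :
    (lef ω ^ p) α ∈ cyc ω θ (l + p) 1 p q :=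
  hω.lef_pow_mem_cyc h hα ⟨dMinus ω θ l α, by
    rw [hω.lich_eq_lef_dMinus hk hα hd, pow_succ, Module.End.mul_apply]⟩

theorem lef_pow_mem_cyc_top (hω : IsLCS ω θ) (h : k + p = n) (hα : α ∈ homog (2 * n) M k) :
    (lef ω ^ p) α ∈ cyc ω θ (l + p) 1 p n :=
  hω.lef_pow_mem_cyc h hα ⟨_, (lef_pow_lich_eq hω.isNondegenerate θ l h hα).symm⟩

theorem lef_pow_mem_pageBoundary_of_mem_coboundaries (hω : IsLCS ω θ) (h : k + p = q)
    (hα : α ∈ coboundaries θ l k) : (lef ω ^ p) α ∈ pageBoundary ω θ (l + p) 1 p q :=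
  lef_pow_mem_pageBoundary hω.d_form h (sub_add_cancel k 2) (zero_mem _)
    (by rwa [map_zero, sub_zero])

theorem lef_pow_lef_mem_pageBoundary (hω : IsLCS ω θ) (h : k + p = q) (hik : i + 2 = k)
    (hγ : γ ∈ homog (2 * n) M i) :
    (lef ω ^ p) (lef ω γ) ∈ pageBoundary ω θ (l + p) 1 p q :=
  lef_pow_mem_pageBoundary hω.d_form h hik hγ (by rw [sub_self]; exact zero_mem _)

theorem lef_pow_sub_lef_pow_primProj_mem_pageBoundary (hω : IsLCS ω θ) (h : k + p = q)
    (hα : α ∈ homog (2 * n) M k) :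
    (lef ω ^ p) α - (lef ω ^ p) (primProj ω α) ∈ pageBoundary ω θ (l + p) 1 p q := by
  obtain ⟨γ, hγ, hαγ⟩ := exists_primProj_add_lef_eq hω.isNondegenerate (sub_add_cancel k 2) hα
  rw [← map_sub, ← eq_sub_of_add_eq' hαγ]
  exact hω.lef_pow_lef_mem_pageBoundary h (sub_add_cancel k 2) hγ

theorem lef_pow_primProj_mem_pageBoundary_iff (hω : IsLCS ω θ) (h : k + p = q)
    (hα : α ∈ homog (2 * n) M k) :
    (lef ω ^ p) (primProj ω α) ∈ pageBoundary ω θ (l + p) 1 p q ↔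
      (lef ω ^ p) α ∈ pageBoundary ω θ (l + p) 1 p q := by
  rw [← Submodule.add_mem_iff_left _ (hω.lef_pow_sub_lef_pow_primProj_mem_pageBoundary h hα),
    add_sub_cancel]

theorem lef_pow_mem_pageBoundary_iff (hω : IsLCS ω θ) (h : k + p = q) (hq : q ≤ n)
    (hik : i + 2 = k) (hα : α ∈ homog (2 * n) M k) :
    (lef ω ^ p) α ∈ pageBoundary ω θ (l + p) 1 p q ↔
      ∃ γ ∈ homog (2 * n) M i, α - lef ω γ ∈ coboundaries θ l k := by
  refine ⟨fun hB => ?_, fun ⟨γ, hγ, hαγ⟩ => lef_pow_mem_pageBoundary hω.d_form h hik hγ hαγ⟩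
  obtain ⟨γ, hγ, β, hβ, lef_pow_eq⟩ := (mem_pageBoundary_one hω.d_form h hik).1 hB
  have add_mem_homog : lef ω γ + β ∈ homog (2 * n) M k :=
    add_mem (lef_mem_homog ω hik hγ) (coboundaries_le_homog θ l k hβ)
  have eq_add : α - (lef ω γ + β) = 0 :=
    eq_zero_of_lef_pow_eq_zero hω.isNondegenerate (r := p) (by push_cast; omega)
      (sub_mem hα add_mem_homog) (by rw [map_sub, lef_pow_eq, sub_self])
  exact ⟨γ, hγ, by rwa [sub_eq_zero.1 eq_add, add_sub_cancel_left]⟩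

theorem dMinus_mem_coboundaries (hω : IsLCS ω θ) (h : k + p = q) (hq : q ≤ n) (hik : i + 1 = k)
    (hx : x ∈ homog (2 * n) M k) (hB : (lef ω ^ p) x ∈ pageBoundary ω θ (l + p) 1 p q) :
    dMinus ω θ l x ∈ coboundaries θ (l - 1) i := by
  obtain ⟨γ, hγ, hxγ⟩ :=
    (hω.lef_pow_mem_pageBoundary_iff h hq (show i - 1 + 2 = k by omega) hx).1 hB
  rw [hω.dMinus_eq_of_sub_lef_mem_coboundaries (by omega) (by omega) hγ hxγ]
  exact (mem_coboundaries (sub_add_cancel i 1)).2 ⟨γ, hγ, rfl⟩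

theorem dMinus_mem_cocycles (hω : IsLCS ω θ) (hik : i + 1 = k) (hk : k + 1 ≤ n)
    (hx : x ∈ homog (2 * n) M k) (hd : dPlus ω θ l x = 0) :
    dMinus ω θ l x ∈ cocycles θ (l - 1) i := by
  have mem_homog := dMinus_mem_homog hω.isNondegenerate θ l hik (by omega) hx
  refine ⟨eq_zero_of_lef_eq_zero hω.isNondegenerate hk (lich_mem_homog θ (l - 1) hik mem_homog) ?_,
    mem_homog⟩
  rw [← hω.lich_lef, ← hω.lich_eq_lef_dMinus (by omega) hx hd, hω.lich_lich]

theorem mem_minusCocycles_iff (hω : IsLCS ω θ) (hl : l + r = l') (hkr : k + r = n)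
    (hα : α ∈ homog (2 * n) M k) :
    α ∈ minusCocycles ω θ l k ↔ lich θ l' ((lef ω ^ r) α) = 0 := by
  rw [Submodule.mem_inf, and_iff_left hα, LinearMap.mem_ker,
    dMinus_eq_zero_iff hω.isNondegenerate θ l hkr hα, hω.lich_lef_pow hl]

theorem dMinus_mem_minusCocycles (hω : IsLCS ω θ) (hik : i + 1 = k) (hkp : k + p = n)
    (hx : x ∈ homog (2 * n) M k) : dMinus ω θ l x ∈ minusCocycles ω θ (l - 1) i := by
  rw [hω.mem_minusCocycles_iff (r := p + 1) rfl (by push_cast; omega)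
      (dMinus_mem_homog hω.isNondegenerate θ l hik (by omega) hx),
    ← lef_pow_lich_eq hω.isNondegenerate θ l hkp hx,
    ← hω.lich_lef_pow (show l + p = l - 1 + (p + 1 : ℕ) by push_cast; ring), hω.lich_lich]

theorem dPlus_eq_zero_of_lef_pow_mem_cyc (hω : IsLCS ω θ) (h : k + p = q) (hq : q + 1 ≤ n)
    (hα : α ∈ homog (2 * n) M k) (hc : (lef ω ^ p) α ∈ cyc ω θ (l + p) 1 p q) :
    dPlus ω θ l α = 0 := by
  have lich_mem := lich_mem_homog θ l rfl hα
  have lef_pow_lich_mem := ((mem_cyc_one h).1 hc).2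
  rw [hω.lich_lef_pow rfl] at lef_pow_lich_mem
  obtain ⟨γ, hγ, lef_pow_eq⟩ := exists_homog_of_mem_range (i := k - 1) (by push_cast; omega)
    (lef_pow_mem_homog ω rfl lich_mem) lef_pow_lich_mem
  have lich_sub_lef_eq_zero : lich θ l α - lef ω γ = 0 :=
    eq_zero_of_lef_pow_eq_zero hω.isNondegenerate (r := p) (by push_cast; omega)
      (sub_mem lich_mem (lef_mem_homog ω (by omega) hγ))
      (by rw [map_sub, ← lef_pow_eq, pow_succ, Module.End.mul_apply, sub_self])
  rw [dPlus, LinearMap.comp_apply, sub_eq_zero.1 lich_sub_lef_eq_zero,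
    primProj_lef hω.isNondegenerate]

theorem exists_prim_sub_mem_pageBoundary (hω : IsLCS ω θ) (h : k + p = q)
    (ha : α ∈ cyc ω θ (l + p) 1 p q) :
    ∃ x ∈ prim ω k, α - (lef ω ^ p) x ∈ pageBoundary ω θ (l + p) 1 p q := by
  obtain ⟨⟨β, hβ, rfl⟩, -⟩ := (mem_cyc_one h).1 ha
  exact ⟨primProj ω β, primProj_mem_prim hω.isNondegenerate hβ,
    hω.lef_pow_sub_lef_pow_primProj_mem_pageBoundary h hβ⟩

theorem exists_prim_dPlus_eq_zero_sub_mem_pageBoundary (hω : IsLCS ω θ) (h : k + p = q)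
    (hq : q + 1 ≤ n) (ha : α ∈ cyc ω θ (l + p) 1 p q) :
    ∃ x ∈ prim ω k ⊓ LinearMap.ker (dPlus ω θ l),
      α - (lef ω ^ p) x ∈ pageBoundary ω θ (l + p) 1 p q := by
  obtain ⟨⟨β, hβ, rfl⟩, -⟩ := (mem_cyc_one h).1 ha
  refine ⟨primProj ω β, ⟨primProj_mem_prim hω.isNondegenerate hβ, LinearMap.mem_ker.2 ?_⟩,
    hω.lef_pow_sub_lef_pow_primProj_mem_pageBoundary h hβ⟩
  rw [hω.dPlus_primProj l hβ]
  exact hω.dPlus_eq_zero_of_lef_pow_mem_cyc h hq hβ ha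

/-! ### Exactness on representatives -/

theorem lef_pow_mem_pageBoundary_iff_of_mem_minusCocycles (hω : IsLCS ω θ) (h : k + p = q)
    (hq : q ≤ n) (hik : i + 2 = k) (hα : α ∈ minusCocycles ω θ l k) :
    (lef ω ^ p) α ∈ pageBoundary ω θ (l + p) 1 p q ↔
      ∃ β ∈ cocycles θ (l - 1) i, α - lef ω β ∈ coboundaries θ l k := by
  rw [hω.lef_pow_mem_pageBoundary_iff h hq hik hα.2]
  refine ⟨fun ⟨γ, hγ, hαγ⟩ => ⟨γ, ⟨?_, hγ⟩, hαγ⟩, fun ⟨β, hβ, hαβ⟩ => ⟨β, hβ.2, hαβ⟩⟩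
  exact (hω.dMinus_eq_of_sub_lef_mem_coboundaries hik (by omega) hγ hαγ).symm.trans hα.1

theorem exists_sub_lef_mem_minusCocycles (hω : IsLCS ω θ) (hik : i + 1 = k) (hjk : j + 2 = k)
    (hk : k ≤ n) (hx : x ∈ homog (2 * n) M k) (h : dMinus ω θ l x ∈ coboundaries θ (l - 1) i) :
    ∃ γ ∈ homog (2 * n) M j, x - lef ω γ ∈ minusCocycles ω θ l k := by
  obtain ⟨γ, hγ, lich_eq⟩ := (mem_coboundaries (show j + 1 = i by omega)).1 h
  refine ⟨γ, hγ, LinearMap.mem_ker.2 ?_, sub_mem hx (lef_mem_homog ω hjk hγ)⟩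
  rw [map_sub, hω.dMinus_lef l (by omega) hγ, lich_eq, sub_self]

theorem dMinus_mem_coboundaries_of_sub_mem_pageBoundary (hω : IsLCS ω θ) (h : k + p = q)
    (hq : q ≤ n) (hik : i + 1 = k) (hx : x ∈ homog (2 * n) M k) (hα : α ∈ minusCocycles ω θ l k)
    (hB : (lef ω ^ p) x - (lef ω ^ p) α ∈ pageBoundary ω θ (l + p) 1 p q) :
    dMinus ω θ l x ∈ coboundaries θ (l - 1) i := by
  rw [← map_sub] at hB
  have dMinus_sub_mem := hω.dMinus_mem_coboundaries h hq hik (sub_mem hx hα.2) hB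
  rwa [map_sub, LinearMap.mem_ker.1 hα.1, sub_zero] at dMinus_sub_mem

theorem dMinus_mem_coboundaries_iff_exists_minusCocycle (hω : IsLCS ω θ) (h : k + p = q)
    (hq : q ≤ n) (hik : i + 1 = k) (hx : x ∈ homog (2 * n) M k) :
    dMinus ω θ l x ∈ coboundaries θ (l - 1) i ↔ ∃ α ∈ minusCocycles ω θ l k,
      (lef ω ^ p) x - (lef ω ^ p) (primProj ω α) ∈ pageBoundary ω θ (l + p) 1 p q := by
  have sub_mem_iff : ∀ α ∈ minusCocycles ω θ l k,
      ((lef ω ^ p) x - (lef ω ^ p) (primProj ω α) ∈ pageBoundary ω θ (l + p) 1 p q ↔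
        (lef ω ^ p) x - (lef ω ^ p) α ∈ pageBoundary ω θ (l + p) 1 p q) := fun α hα => by
    rw [← sub_add_sub_cancel _ ((lef ω ^ p) α), Submodule.add_mem_iff_left _
      (hω.lef_pow_sub_lef_pow_primProj_mem_pageBoundary h hα.2)]
  refine ⟨fun hd => ?_, fun ⟨α, hα, hB⟩ => hω.dMinus_mem_coboundaries_of_sub_mem_pageBoundary h hq
    hik hx hα ((sub_mem_iff α hα).1 hB)⟩
  obtain ⟨γ, hγ, hxγ⟩ :=
    hω.exists_sub_lef_mem_minusCocycles hik (sub_add_cancel k 2) (by omega) hx hd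
  refine ⟨x - lef ω γ, hxγ, (sub_mem_iff _ hxγ).2 ?_⟩
  rw [← map_sub, sub_sub_cancel]
  exact hω.lef_pow_lef_mem_pageBoundary h (sub_add_cancel k 2) hγ

theorem dMinus_mem_coboundaries_iff_exists_cocycle (hω : IsLCS ω θ) (h : k + p = q) (hq : q ≤ n)
    (hik : i + 1 = k) (hx : x ∈ homog (2 * n) M k) (hd : dPlus ω θ l x = 0) :
    dMinus ω θ l x ∈ coboundaries θ (l - 1) i ↔ ∃ α ∈ cocycles θ l k,
      (lef ω ^ p) x - (lef ω ^ p) α ∈ pageBoundary ω θ (l + p) 1 p q := by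
  refine ⟨fun hm => ?_, fun ⟨α, hα, hB⟩ => hω.dMinus_mem_coboundaries_of_sub_mem_pageBoundary h hq
    hik hx (cocycles_le_minusCocycles ω θ l k hα) hB⟩
  obtain ⟨γ, hγ, hxγ⟩ :=
    hω.exists_sub_lef_mem_minusCocycles hik (sub_add_cancel k 2) (by omega) hx hm
  refine ⟨x - lef ω γ, ⟨LinearMap.mem_ker.2 ?_, hxγ.2⟩, ?_⟩
  · have dPlus_sub : dPlus ω θ l (x - lef ω γ) = 0 := by rw [map_sub, hd, hω.dPlus_lef, sub_zero]
    rw [hω.lich_eq_lef_dMinus (by omega) hxγ.2 dPlus_sub, LinearMap.mem_ker.1 hxγ.1, map_zero]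
  · rw [← map_sub, sub_sub_cancel]
    exact hω.lef_pow_lef_mem_pageBoundary h (sub_add_cancel k 2) hγ

theorem lef_mem_coboundaries_iff (hω : IsLCS ω θ) (hik : i + 1 = k) (hij : i + 2 = j) (hk : k ≤ n)
    (hβ : β ∈ homog (2 * n) M i) :
    lef ω β ∈ coboundaries θ l j ↔ ∃ x ∈ prim ω k ⊓ LinearMap.ker (dPlus ω θ l),
      β - dMinus ω θ l x ∈ coboundaries θ (l - 1) i := by
  constructor
  · intro h
    obtain ⟨α, hα, lich_eq⟩ := (mem_coboundaries (show k + 1 = j by omega)).1 h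
    replace lich_eq : lich θ l α = 0 + lef ω β := by rw [lich_eq, zero_add]
    have dPlus_eq : dPlus ω θ l α = 0 :=
      dPlus_eq_of_lich_eq hω.isNondegenerate (zero_mem (prim ω 0)) lich_eq
    have dMinus_eq : dMinus ω θ l α = β :=
      dMinus_eq_of_lich_eq hω.isNondegenerate (zero_mem (prim ω 0)) hβ (by omega) lich_eq
    refine ⟨primProj ω α, ⟨primProj_mem_prim hω.isNondegenerate hα, ?_⟩, ?_⟩
    · exact (hω.dPlus_primProj l hα).trans dPlus_eq
    · rw [← dMinus_eq]
      exact hω.dMinus_sub_dMinus_primProj_mem_coboundaries l hik hk hα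
  · rintro ⟨x, ⟨hx, hd⟩, hβx⟩
    have mem_homog := prim_le_homog ω k hx
    rw [← add_sub_cancel (dMinus ω θ l x) β, map_add, ← hω.lich_eq_lef_dMinus hk mem_homog hd]
    exact add_mem ((mem_coboundaries (by omega)).2 ⟨x, mem_homog, rfl⟩)
      (hω.lef_mem_coboundaries hij hβx)

theorem lef_pow_succ_mem_coboundaries_iff (hω : IsLCS ω θ) (hik : i + 1 = k) (hk : k + p = n)
    (hj : n + p + 1 = j) (hβ : β ∈ homog (2 * n) M i) :
    (lef ω ^ (p + 1)) β ∈ coboundaries θ (l + p) j ↔ ∃ x ∈ prim ω k,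
      β - dMinus ω θ l x ∈ coboundaries θ (l - 1) i := by
  constructor
  · intro h
    obtain ⟨ζ, hζ, lich_eq⟩ := (mem_coboundaries hj).1 h
    obtain ⟨α, hα, rfl⟩ := exists_lef_pow_eq hω.isNondegenerate (i := k) (r := p)
      (by push_cast; omega) (by omega) hζ
    rw [hω.lich_lef_pow rfl, lef_pow_lich_eq hω.isNondegenerate θ l hk hα] at lich_eq
    have sub_dMinus_eq_zero : β - dMinus ω θ l α = 0 :=
      eq_zero_of_lef_pow_eq_zero hω.isNondegenerate (r := p + 1) (by push_cast; omega)
        (sub_mem hβ (dMinus_mem_homog hω.isNondegenerate θ l hik (by omega) hα))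
        (by rw [map_sub, lich_eq, sub_self])
    refine ⟨primProj ω α, primProj_mem_prim hω.isNondegenerate hα, ?_⟩
    rw [sub_eq_zero.1 sub_dMinus_eq_zero]
    exact hω.dMinus_sub_dMinus_primProj_mem_coboundaries l hik (by omega) hα
  · rintro ⟨x, hx, hβx⟩
    have mem_homog := prim_le_homog ω k hx
    rw [← add_sub_cancel (dMinus ω θ l x) β, map_add,
      ← lef_pow_lich_eq hω.isNondegenerate θ l hk mem_homog, ← hω.lich_lef_pow rfl]
    exact add_mem ((mem_coboundaries hj).2 ⟨_, lef_pow_mem_homog ω (by omega) mem_homog, rfl⟩)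
      (hω.lef_pow_mem_coboundaries (by push_cast; ring) (by push_cast; omega) hβx)

theorem exists_minusCocycle_lef_pow_eq (hω : IsLCS ω θ) (hip : i + p + 1 = n)
    (hj : n + p + 1 = j) (hα : α ∈ cocycles θ (l + p) j) :
    ∃ β ∈ minusCocycles ω θ (l - 1) i, (lef ω ^ (p + 1)) β = α := by
  obtain ⟨β, hβ, rfl⟩ := exists_lef_pow_eq hω.isNondegenerate (i := i) (r := p + 1)
    (by push_cast; omega) (by push_cast; omega) hα.2
  exact ⟨β, (hω.mem_minusCocycles_iff (l' := l + p) (by push_cast; ring) (by push_cast; omega)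
    hβ).2 hα.1, rfl⟩

/-! ### The maps of the sequence -/

theorem exists_lef_coh (hω : IsLCS ω θ) (l : ℤ) (hij : i + 2 = j) :
    ∃ φ : Coh θ (l - 1) i →ₗ[ℝ] Coh θ l j, IsInducedBy φ (lef ω) :=
  exists_isInducedBy (fun _ => hω.lef_mem_cocycles hij) fun _ _ => hω.lef_mem_coboundaries hij

theorem exists_lef_pow_coh_page (hω : IsLCS ω θ) (l : ℤ) (h : k + p = q) :
    ∃ φ : Coh θ l k →ₗ[ℝ] Page ω θ (l + p) 1 p q, IsInducedBy φ (lef ω ^ p) :=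
  exists_isInducedBy (fun _ => hω.lef_pow_mem_cyc_of_mem_cocycles h) fun _ _ =>
    hω.lef_pow_mem_pageBoundary_of_mem_coboundaries h

theorem exists_dMinus_page_coh (hω : IsLCS ω θ) (l : ℤ) (h : k + p = q) (hq : q + 1 ≤ n)
    (hik : i + 1 = k) :
    ∃ φ : Page ω θ (l + p) 1 p q →ₗ[ℝ] Coh θ (l - 1) i,
      IsGivenBy φ (prim ω k ⊓ LinearMap.ker (dPlus ω θ l)) (lef ω ^ p) (dMinus ω θ l) :=
  exists_isGivenBy
    (fun _ hx => hω.lef_pow_mem_cyc_of_dPlus_eq_zero h (by omega) (prim_le_homog ω k hx.1) hx.2)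
    (fun _ hx => hω.dMinus_mem_cocycles hik (by omega) (prim_le_homog ω k hx.1) hx.2)
    (fun _ => hω.exists_prim_dPlus_eq_zero_sub_mem_pageBoundary h hq)
    (fun _ hx => hω.dMinus_mem_coboundaries h (by omega) hik (prim_le_homog ω k hx.1))

theorem exists_lef_coh_cgroup (hω : IsLCS ω θ) (l : ℤ) (hij : i + 2 = j) :
    ∃ φ : Coh θ (l - 1) i →ₗ[ℝ] CGroup ω θ l j, IsInducedBy φ (lef ω) :=
  exists_isInducedBy
    (fun _ hα => cocycles_le_minusCocycles ω θ l j (hω.lef_mem_cocycles hij hα))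
    fun _ _ => hω.lef_mem_coboundaries hij

theorem exists_lef_pow_primProj_cgroup_page (hω : IsLCS ω θ) (l : ℤ) (h : k + p = n) :
    ∃ φ : CGroup ω θ l k →ₗ[ℝ] Page ω θ (l + p) 1 p n,
      IsInducedBy φ ((lef ω ^ p) ∘ₗ primProj ω) :=
  exists_isInducedBy
    (fun _ hα => hω.lef_pow_mem_cyc_top h
      (prim_le_homog ω k (primProj_mem_prim hω.isNondegenerate hα.2)))
    fun _ hα hB => (hω.lef_pow_primProj_mem_pageBoundary_iff h hα.2).2
      (hω.lef_pow_mem_pageBoundary_of_mem_coboundaries h hB)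

theorem exists_dMinus_page_cgroup (hω : IsLCS ω θ) (l : ℤ) (h : k + p = n) (hik : i + 1 = k) :
    ∃ φ : Page ω θ (l + p) 1 p n →ₗ[ℝ] CGroup ω θ (l - 1) i,
      IsGivenBy φ (prim ω k) (lef ω ^ p) (dMinus ω θ l) :=
  exists_isGivenBy
    (fun _ hx => hω.lef_pow_mem_cyc_top h (prim_le_homog ω k hx))
    (fun _ hx => hω.dMinus_mem_minusCocycles hik h (prim_le_homog ω k hx))
    (fun _ => hω.exists_prim_sub_mem_pageBoundary h)
    (fun _ hx => hω.dMinus_mem_coboundaries h le_rfl hik (prim_le_homog ω k hx))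

theorem exists_lef_pow_succ_cgroup_coh (hω : IsLCS ω θ) (l : ℤ) (hip : i + p + 1 = n)
    (hj : n + p + 1 = j) :
    ∃ φ : CGroup ω θ (l - 1) i →ₗ[ℝ] Coh θ (l + p) j, IsInducedBy φ (lef ω ^ (p + 1)) :=
  exists_isInducedBy
    (fun _ hα => ⟨(hω.mem_minusCocycles_iff (by push_cast; ring) (by push_cast; omega) hα.2).1 hα,
      lef_pow_mem_homog ω (by push_cast; omega) hα.2⟩)
    fun _ _ => hω.lef_pow_mem_coboundaries (by push_cast; ring) (by push_cast; omega)

/-! ### Exactness -/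

theorem exact_lef_lef_pow (hω : IsLCS ω θ) (hij : i + 2 = j) (h : j + p = q) (hq : q ≤ n)
    {φ : Coh θ (l - 1) i →ₗ[ℝ] Coh θ l j} {ψ : Coh θ l j →ₗ[ℝ] Page ω θ (l + p) 1 p q}
    (hφ : IsInducedBy φ (lef ω)) (hψ : IsInducedBy ψ (lef ω ^ p)) : Function.Exact φ ψ :=
  hφ.exact hψ fun _ hα => hω.lef_pow_mem_pageBoundary_iff_of_mem_minusCocycles h hq hij
    (cocycles_le_minusCocycles ω θ l j hα)

theorem exact_lef_pow_dMinus (hω : IsLCS ω θ) (h : k + p = q) (hq : q ≤ n) (hik : i + 1 = k)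
    {φ : Coh θ l k →ₗ[ℝ] Page ω θ (l + p) 1 p q} {ψ : Page ω θ (l + p) 1 p q →ₗ[ℝ] Coh θ (l - 1) i}
    (hφ : IsInducedBy φ (lef ω ^ p))
    (hψ : IsGivenBy ψ (prim ω k ⊓ LinearMap.ker (dPlus ω θ l)) (lef ω ^ p) (dMinus ω θ l)) :
    Function.Exact φ ψ :=
  hφ.exact hψ fun _ hx =>
    hω.dMinus_mem_coboundaries_iff_exists_cocycle h hq hik (prim_le_homog ω k hx.1) hx.2

theorem exact_dMinus_lef (hω : IsLCS ω θ) (hik : i + 1 = k) (hij : i + 2 = j) (hk : k ≤ n)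
    {φ : Page ω θ (l + p) 1 p q →ₗ[ℝ] Coh θ (l - 1) i} {ψ : Coh θ (l - 1) i →ₗ[ℝ] Coh θ l j}
    (hφ : IsGivenBy φ (prim ω k ⊓ LinearMap.ker (dPlus ω θ l)) (lef ω ^ p) (dMinus ω θ l))
    (hψ : IsInducedBy ψ (lef ω)) : Function.Exact φ ψ :=
  hφ.exact hψ fun _ hβ => hω.lef_mem_coboundaries_iff hik hij hk hβ.2

theorem exact_dMinus_lef_cgroup (hω : IsLCS ω θ) (hik : i + 1 = k) (hij : i + 2 = j) (hk : k ≤ n)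
    {φ : Page ω θ (l + p) 1 p q →ₗ[ℝ] Coh θ (l - 1) i} {ψ : Coh θ (l - 1) i →ₗ[ℝ] CGroup ω θ l j}
    (hφ : IsGivenBy φ (prim ω k ⊓ LinearMap.ker (dPlus ω θ l)) (lef ω ^ p) (dMinus ω θ l))
    (hψ : IsInducedBy ψ (lef ω)) : Function.Exact φ ψ :=
  hφ.exact hψ fun _ hβ => hω.lef_mem_coboundaries_iff hik hij hk hβ.2

theorem exact_lef_lef_pow_primProj (hω : IsLCS ω θ) (hik : i + 2 = k) (h : k + p = n)
    {φ : Coh θ (l - 1) i →ₗ[ℝ] CGroup ω θ l k} {ψ : CGroup ω θ l k →ₗ[ℝ] Page ω θ (l + p) 1 p n}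
    (hφ : IsInducedBy φ (lef ω)) (hψ : IsInducedBy ψ ((lef ω ^ p) ∘ₗ primProj ω)) :
    Function.Exact φ ψ :=
  hφ.exact hψ fun _ hα => (hω.lef_pow_primProj_mem_pageBoundary_iff h hα.2).trans
    (hω.lef_pow_mem_pageBoundary_iff_of_mem_minusCocycles h le_rfl hik hα)

theorem exact_lef_pow_primProj_dMinus (hω : IsLCS ω θ) (h : k + p = n) (hik : i + 1 = k)
    {φ : CGroup ω θ l k →ₗ[ℝ] Page ω θ (l + p) 1 p n}
    {ψ : Page ω θ (l + p) 1 p n →ₗ[ℝ] CGroup ω θ (l - 1) i}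
    (hφ : IsInducedBy φ ((lef ω ^ p) ∘ₗ primProj ω))
    (hψ : IsGivenBy ψ (prim ω k) (lef ω ^ p) (dMinus ω θ l)) : Function.Exact φ ψ :=
  hφ.exact hψ fun _ hx =>
    hω.dMinus_mem_coboundaries_iff_exists_minusCocycle h le_rfl hik (prim_le_homog ω k hx)

theorem exact_dMinus_lef_pow_succ (hω : IsLCS ω θ) (hik : i + 1 = k) (h : k + p = n)
    (hj : n + p + 1 = j) {φ : Page ω θ (l + p) 1 p n →ₗ[ℝ] CGroup ω θ (l - 1) i}
    {ψ : CGroup ω θ (l - 1) i →ₗ[ℝ] Coh θ (l + p) j}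
    (hφ : IsGivenBy φ (prim ω k) (lef ω ^ p) (dMinus ω θ l))
    (hψ : IsInducedBy ψ (lef ω ^ (p + 1))) : Function.Exact φ ψ :=
  hφ.exact hψ fun _ hβ => hω.lef_pow_succ_mem_coboundaries_iff hik h hj hβ.2

theorem surjective_lef_pow_succ (hω : IsLCS ω θ) (hip : i + p + 1 = n) (hj : n + p + 1 = j)
    {φ : CGroup ω θ (l - 1) i →ₗ[ℝ] Coh θ (l + p) j} (hφ : IsInducedBy φ (lef ω ^ (p + 1))) :
    Function.Surjective φ :=
  hφ.surjective fun _ => hω.exists_minusCocycle_lef_pow_eq hip hj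

end IsLCS

end LCS

end

theorem proposition4p6 (n : ℕ) {M : Type*} [TopologicalSpace M]
    [ChartedSpace (LCS.Model (2 * n)) M] [IsManifold (𝓡 (2 * n)) (⊤ : ℕ∞) M]
    (ω : LCS.Form (2 * n) M 2) (θ : LCS.Form (2 * n) M 1) (hω : LCS.IsLCS ω θ)
    (l : ℤ) (p : ℕ) (hp : p + 1 ≤ n) :
    -- the maps of the long exact sequence
    ∃ (Lbar : ∀ i j : ℤ, i + 2 = j → (LCS.Coh θ (l - 1) i →ₗ[ℝ] LCS.Coh θ l j))
      (Lpbar : ∀ k q : ℤ, k + p = q → (LCS.Coh θ l k →ₗ[ℝ] LCS.Page ω θ (l + p) 1 p q))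
      (δ : ∀ q k : ℤ, p ≤ q → q ≤ (n : ℤ) - 1 → q - (p + 1) = k →
        (LCS.Page ω θ (l + p) 1 p q →ₗ[ℝ] LCS.Coh θ (l - 1) k))
      -- the maps of its extension
      (L' : LCS.Coh θ (l - 1) (n - (p + 2)) →ₗ[ℝ] LCS.CGroup ω θ l (n - p))
      (Lp' : LCS.CGroup ω θ l (n - p) →ₗ[ℝ] LCS.Page ω θ (l + p) 1 p n)
      (δn : LCS.Page ω θ (l + p) 1 p n →ₗ[ℝ] LCS.CGroup ω θ (l - 1) (n - (p + 1)))
      (Lp1 : LCS.CGroup ω θ (l - 1) (n - (p + 1)) →ₗ[ℝ] LCS.Coh θ (l + p) (n + p + 1)),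
      -- how they act on representatives
      (∀ i j h, LCS.IsInducedBy (Lbar i j h) (LCS.lef ω)) ∧
      (∀ k q h, LCS.IsInducedBy (Lpbar k q h) (LCS.lef ω ^ p)) ∧
      (∀ q k h₁ h₂ h₃, LCS.IsGivenBy (δ q k h₁ h₂ h₃)
        (LCS.prim ω (q - p) ⊓ LinearMap.ker (LCS.dPlus ω θ l)) (LCS.lef ω ^ p)
        (LCS.dMinus ω θ l)) ∧
      LCS.IsInducedBy L' (LCS.lef ω) ∧
      LCS.IsInducedBy Lp' ((LCS.lef ω ^ p) ∘ₗ LCS.primProj ω) ∧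
      LCS.IsGivenBy δn (LCS.prim ω (n - p)) (LCS.lef ω ^ p) (LCS.dMinus ω θ l) ∧
      LCS.IsInducedBy Lp1 (LCS.lef ω ^ (p + 1)) ∧
      -- exactness of the long exact sequence
      (∀ (i j q : ℤ) (h : i + 2 = j) (h' : j + p = q), p ≤ q → q ≤ n →
        Function.Exact (Lbar i j h) (Lpbar j q h')) ∧
      (∀ (j q k : ℤ) (h : j + p = q) (h₁ : p ≤ q) (h₂ : q ≤ (n : ℤ) - 1) (h₃ : q - (p + 1) = k),
        Function.Exact (Lpbar j q h) (δ q k h₁ h₂ h₃)) ∧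
      (∀ (q k j : ℤ) (h₁ : p ≤ q) (h₂ : q ≤ (n : ℤ) - 1) (h₃ : q - (p + 1) = k) (h : k + 2 = j),
        Function.Exact (δ q k h₁ h₂ h₃) (Lbar k j h)) ∧
      -- exactness of its extension
      Function.Exact (δ (n - 1) (n - (p + 2)) (by omega) le_rfl (by ring)) L' ∧
      Function.Exact L' Lp' ∧
      Function.Exact Lp' δn ∧
      Function.Exact δn Lp1 ∧
      Function.Surjective Lp1 := by
  choose Lbar hLbar using fun (i j : ℤ) (h : i + 2 = j) => hω.exists_lef_coh l h
  choose Lpbar hLpbar using fun (k q : ℤ) (h : k + p = q) => hω.exists_lef_pow_coh_page l h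
  choose δ hδ using fun (q k : ℤ) (_ : p ≤ q) (h₂ : q ≤ (n : ℤ) - 1) (h₃ : q - (p + 1) = k) =>
    hω.exists_dMinus_page_coh l (sub_add_cancel q p) (by omega) (show k + 1 = q - p by omega)
  obtain ⟨L', hL'⟩ :=
    hω.exists_lef_coh_cgroup l (show (n : ℤ) - (p + 2) + 2 = n - p by ring)
  obtain ⟨Lp', hLp'⟩ := hω.exists_lef_pow_primProj_cgroup_page l (sub_add_cancel (n : ℤ) p)
  obtain ⟨δn, hδn⟩ := hω.exists_dMinus_page_cgroup l (sub_add_cancel (n : ℤ) p)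
    (show (n : ℤ) - (p + 1) + 1 = n - p by ring)
  obtain ⟨Lp1, hLp1⟩ :=
    hω.exists_lef_pow_succ_cgroup_coh l (show (n : ℤ) - (p + 1) + p + 1 = n by ring) rfl
  refine ⟨Lbar, Lpbar, δ, L', Lp', δn, Lp1, hLbar, hLpbar, hδ, hL', hLp', hδn, hLp1,
    fun i j q h h' _ hq => hω.exact_lef_lef_pow h h' hq (hLbar i j h) (hLpbar j q h'),
    fun j q k h h₁ h₂ h₃ => ?_,
    fun q k j h₁ h₂ h₃ h =>
      hω.exact_dMinus_lef (by omega) h (by omega) (hδ q k h₁ h₂ h₃) (hLbar k j h),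
    hω.exact_dMinus_lef_cgroup (by ring) (by ring) (by omega) (hδ _ _ _ _ _) hL',
    hω.exact_lef_lef_pow_primProj (by ring) (by ring) hL' hLp',
    hω.exact_lef_pow_primProj_dMinus (by ring) (by ring) hLp' hδn,
    hω.exact_dMinus_lef_pow_succ (by ring) (by ring) rfl hδn hLp1,
    hω.surjective_lef_pow_succ (by ring) rfl hLp1⟩
  obtain rfl : j = q - p := by omega
  exact hω.exact_lef_pow_dMinus h (by omega) (by omega) (hLpbar _ q h) (hδ q k h₁ h₂ h₃)
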